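/- A \emph{map} is a finite connected graph (loops and multiple edges allowed) embedded in the sphere, with a marked oriented edge, the root edge (so there is at least one edge), considered up to orientation-preserving homeomorphisms that respect the root edge; the \emph{root face} is the face to the left of the root edge. A \emph{tree} is a map with a single face. A \emph{map with a simple boundary} of size $2m$ with $f$ internal faces is a map with $f+1$ faces whose root face (the external face) has degree $2m$ and is bounded by a simple closed curve (no vertex and no edge is visited twice). A \emph{tree-decorated map} is a map together with a subset of its edges that forms a submap which is a tree; two of them are the same if an isomorphism of the maps takes one tree to the other. Let $f,m\in\mathbb N$. The set of tree-decorated maps with $f$ faces, decorated by a tree with $m$ edges that contains the root edge, is in bijection with the set of pairs (tree with $m$ edges, map with a simple boundary of size $2m$ and $f$ internal faces). More precisely, the following \emph{ungluing} map $\phi$ is a well-defined bijection, and its inverse is the following \emph{gluing} $\psi$. \emph{Ungluing.} $\phi(\mathfrak m,\mathfrak t)=(\mathfrak t,\mathfrak m^b)$, where $\mathfrak t$ carries the root edge of $\mathfrak m$ and the cyclic orders inherited from $\mathfrak m$, and $\mathfrak m^b$ arises from $\mathfrak m$ by duplicating each edge of $\mathfrak t$, which opens a new external face. That is, each vertex of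 $\mathfrak t$ is split into its corners (a corner at $v$ is the sector between two clockwise consecutive oriented edges $s,s'$ of $\mathfrak t$ starting at $v$). For each oriented edge $s$ of $\mathfrak t$ a new oriented edge $\bar s$ is added, which has the external face to its left and whose reverse is the old reverse of $s$. At the corner from $s$ to $s'$ the clockwise order is $\bar s$, then the oriented edges of $\mathfrak m$ strictly between $s$ and $s'$, then $s'$. All other cyclic orders are kept, and the root edge of $\mathfrak m^b$ is $\bar r$, where $r$ is the root edge of $\mathfrak m$. \emph{Gluing.} Let $\mathfrak t'$ be a tree with $m$ edges and $\mathfrak m^b$ a map with a simple boundary of size $2m$ and $f$ internal faces. Label the boundary vertices of $\mathfrak m^b$ by $0,\dots,2m-1$ starting at the root vertex and following the boundary with the external face on the left. Let $C:\{0,\dots,2m\}\to\mathbb N$ be the contour function of $\mathfrak t'$: $C(n)$ is the distance to the root vertex of the vertex visited at time $n$ by a walker who starts along the root edge and follows the tree with his left hand on it. Put $i\sim j$ if $C(i)=C(j)=\min C$ on the interval between $i$ and $j$. Then $\psi(\mathfrak t',\mathfrak m^b)=(\mathfrak m,\mathfrak t)$, where $\mathfrak m$ is the quotient of $\mathfrak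 m^b$ in which boundary vertices with equivalent labels are identified; the boundary edge from label $i$ to label $i+1$ is identified with the reverse of the boundary edge from label $j$ to label $j+1$ exactly if $i\sim j+1$ and $i+1\sim j$; no other vertices or edges are identified; the cyclic orders of edges around vertices are kept except across the corners of the external face; the root edge is the image of the root edge; and $\mathfrak t$ is the image of the boundary. -/

import Mathlib

noncomputable section

/-- A rooted map on a closed oriented (not yet necessarily connected or planar) surface, given by
its darts (oriented edges): `rot d` is the next dart in clockwise order around the starting point
of `d`, `rev d` is `d` with the opposite orientation, and `root` is the root edge. -/
structure RootedMap where
  Dart : Type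
  finite : Finite Dart
  rot : Equiv.Perm Dart
  rev : Equiv.Perm Dart
  rev_rev : ∀ d, rev (rev d) = d
  rev_ne : ∀ d, rev d ≠ d
  root : Dart

namespace RootedMap

/-- The vertices are the cycles of `rot`. -/
def Vertex (M : RootedMap) : Type := Quotient (Equiv.Perm.SameCycle.setoid M.rot)

/-- The starting point of a dart. -/
def origin (M : RootedMap) (d : M.Dart) : M.Vertex :=
  Quotient.mk (Equiv.Perm.SameCycle.setoid M.rot) d

/-- The (unoriented) edges are the cycles of `rev`. -/
def Edge (M : RootedMap) : Type := Quotient (Equiv.Perm.SameCycle.setoid M.rev)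

/-- The next dart along the boundary of the face lying to the left of a dart. -/
def faceNext (M : RootedMap) : Equiv.Perm M.Dart := M.rot * M.rev

/-- The faces are the cycles of `faceNext`. -/
def Face (M : RootedMap) : Type := Quotient (Equiv.Perm.SameCycle.setoid M.faceNext)

/-- The underlying graph is connected. -/
def Connected (M : RootedMap) : Prop :=
  ∀ d e : M.Dart, ∃ g ∈ Subgroup.closure {M.rot, M.rev}, g d = e

/-- A (rooted) planar map: connected and drawn on the sphere, that is, of genus `0`. -/
def IsPlanarMap (M : RootedMap) : Prop :=
  M.Connected ∧ Nat.card M.Vertex + Nat.card M.Face = Nat.card M.Edge + 2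

/-- A planted plane tree with `m` edges: a planar map with a single face. -/
def IsPlaneTree (m : ℕ) (M : RootedMap) : Prop :=
  M.IsPlanarMap ∧ Nat.card M.Face = 1 ∧ Nat.card M.Edge = m

/-- The darts incident to the root face, the face to the left of the root edge. -/
def rootFace (M : RootedMap) : Set M.Dart := {d | M.faceNext.SameCycle M.root d}

/-- A planar map with a simple boundary of size `2 * m` and `f` internal faces. The external face
is the root face. Its boundary is a simple closed curve: it visits no vertex twice and runs through
no edge twice. -/
structure IsSimpleBoundaryMap (f m : ℕ) (M : RootedMap) : Prop where
  planar : M.IsPlanarMap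
  card_face : Nat.card M.Face = f + 1
  size : M.rootFace.ncard = 2 * m
  simple_vertex : ∀ d ∈ M.rootFace, ∀ e ∈ M.rootFace, M.origin d = M.origin e → d = e
  simple_edge : ∀ d ∈ M.rootFace, M.rev d ∉ M.rootFace

/-- The `i`-th oriented edge of the boundary of the root face, counted from the root edge. The
boundary vertex with label `i` is its starting point. -/
def boundaryDart (M : RootedMap) (i : ℕ) : M.Dart := (M.faceNext ^ i) M.root

/-- Two rooted maps are the same if there is an orientation-preserving isomorphism
between them that respects the root edges. -/
def Iso (M N : RootedMap) : Prop :=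
  ∃ e : M.Dart ≃ N.Dart, (∀ d, e (M.rot d) = N.rot (e d)) ∧ (∀ d, e (M.rev d) = N.rev (e d)) ∧
    e M.root = N.root

instance isoSetoid : Setoid RootedMap where
  r := Iso
  iseqv :=
    { refl := fun _ => ⟨Equiv.refl _, fun _ => rfl, fun _ => rfl, rfl⟩
      symm := by
        rintro M N ⟨e, h1, h2, h3⟩
        refine ⟨e.symm, fun d => ?_, fun d => ?_, ?_⟩
        · rw [Equiv.symm_apply_eq, h1, Equiv.apply_symm_apply]
        · rw [Equiv.symm_apply_eq, h2, Equiv.apply_symm_apply]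
        · rw [Equiv.symm_apply_eq, h3]
      trans := by
        rintro M N P ⟨e, h1, h2, h3⟩ ⟨e', h1', h2', h3'⟩
        exact ⟨e.trans e', fun d => by simp [h1, h1'], fun d => by simp [h2, h2'],
          by simp [h3, h3']⟩ }

/-! ### The contour function -/

/-- The graph underlying a map, with loops and multiplicities of edges ignored. -/
def graph (M : RootedMap) : SimpleGraph M.Vertex :=
  SimpleGraph.fromRel fun u v => ∃ d, M.origin d = u ∧ M.origin (M.rev d) = v

/-- The `n`-th oriented edge taken by a walker who starts along the root edge and touches the tree
with the left hand: at the end of an edge he continues with the next one in counterclockwise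
order. -/
def contourDart (M : RootedMap) (n : ℕ) : M.Dart := ((M.rot⁻¹ * M.rev) ^ n) M.root

/-- The contour function: the distance to the root vertex of the vertex visited at time `n`. -/
def contour (M : RootedMap) (n : ℕ) : ℕ :=
  M.graph.dist (M.origin M.root) (M.origin (M.contourDart n))

/-- The equivalence of times of the contour walk: `C i = C j = min C` on the interval between
`i` and `j`. -/
def ContourEquiv (M : RootedMap) (i j : ℕ) : Prop :=
  M.contour i = M.contour j ∧ ∀ k ∈ Set.uIcc i j, M.contour i ≤ M.contour k

/-- The steps `i` (from time `i` to `i + 1`) and `j` of the contour walk have equivalent end points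
with opposite directions. -/
def Matched (M : RootedMap) (i j : ℕ) : Prop :=
  M.ContourEquiv i (j + 1) ∧ M.ContourEquiv (i + 1) j

end RootedMap

/-! ### First return permutation -/

theorem exists_return {D : Type} (hD : Finite D) (p : Equiv.Perm D) (S : Set D) (d : S) :
    ∃ k : ℕ, 0 < k ∧ (p ^ k) (d : D) ∈ S := by
  have := hD
  refine ⟨orderOf p, orderOf_pos p, ?_⟩
  rw [pow_orderOf_eq_one]
  exact d.2

open Classical in
/-- The first element of `S` after `d` in the sequence `d, p d, p (p d), …`. -/
def firstReturn {D : Type} (hD : Finite D) (p : Equiv.Perm D) (S : Set D) (d : S) : S :=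
  ⟨(p ^ Nat.find (exists_return hD p S d)) (d : D), (Nat.find_spec (exists_return hD p S d)).2⟩

theorem firstReturn_injective {D : Type} (hD : Finite D) (p : Equiv.Perm D) (S : Set D) :
    Function.Injective (firstReturn hD p S) := by
  classical
  have key : ∀ d e : S, Nat.find (exists_return hD p S d) ≤ Nat.find (exists_return hD p S e) →
      firstReturn hD p S d = firstReturn hD p S e → d = e := by
    intro d e hle h
    have h' := congrArg Subtype.val h
    simp only [firstReturn] at h'
    obtain ⟨c, hc⟩ := Nat.exists_eq_add_of_le hle
    rw [hc, pow_add, Equiv.Perm.mul_apply] at h'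
    have h2 := (Equiv.injective _) h'
    rcases Nat.eq_zero_or_pos c with rfl | hpos
    · exact Subtype.ext (by simpa using h2)
    · have hlt : c < Nat.find (exists_return hD p S e) := by
        have := (Nat.find_spec (exists_return hD p S d)).1
        omega
      exact absurd ⟨hpos, h2 ▸ d.2⟩ (Nat.find_min (exists_return hD p S e) hlt)
  intro d e h
  rcases le_total (Nat.find (exists_return hD p S d)) (Nat.find (exists_return hD p S e)) with hle | hle
  · exact key d e hle h
  · exact (key e d hle h.symm).symm

/-- The permutation that `p` induces on `S` by skipping the elements outside of `S`. -/
def firstReturnPerm {D : Type} (hD : Finite D) (p : Equiv.Perm D) (S : Set D) : Equiv.Perm S :=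
  have := hD
  Equiv.ofBijective (firstReturn hD p S) (Finite.injective_iff_bijective.1
    (firstReturn_injective hD p S))

/-! ### Decorated maps -/

/-- A rooted map together with a set of edges (a set of darts closed under reversal) that contains
the root edge. -/
structure DecoratedMap where
  map : RootedMap
  decor : Set map.Dart
  rev_mem : ∀ d ∈ decor, map.rev d ∈ decor
  root_mem : map.root ∈ decor

namespace DecoratedMap

/-- The decoration as a map of its own: the submap obtained by suppressing all other edges, with
the cyclic orders around the vertices inherited. -/
def submap (X : DecoratedMap) : RootedMap where
  Dart := X.decor
  finite := have := X.map.finite; inferInstance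
  rot := firstReturnPerm X.map.finite X.map.rot X.decor
  rev := Function.Involutive.toPerm (fun s : X.decor => ⟨X.map.rev s, X.rev_mem s s.2⟩)
    (fun s => Subtype.ext (X.map.rev_rev s))
  rev_rev := fun s => Subtype.ext (X.map.rev_rev s)
  rev_ne := fun s h => X.map.rev_ne s (congrArg Subtype.val h)
  root := ⟨X.map.root, X.root_mem⟩

/-- A planar map with `f` faces, decorated by a tree with `m` edges that contains the root edge. -/
structure IsTreeDecorated (f m : ℕ) (X : DecoratedMap) : Prop where
  planar : X.map.IsPlanarMap
  card_face : Nat.card X.map.Face = f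
  tree : X.submap.IsPlaneTree m

/-- Isomorphism of decorated maps. -/
def Iso (X Y : DecoratedMap) : Prop :=
  ∃ e : X.map.Dart ≃ Y.map.Dart, (∀ d, e (X.map.rot d) = Y.map.rot (e d)) ∧
    (∀ d, e (X.map.rev d) = Y.map.rev (e d)) ∧ e X.map.root = Y.map.root ∧
    ∀ d, e d ∈ Y.decor ↔ d ∈ X.decor

instance isoSetoid : Setoid DecoratedMap where
  r := Iso
  iseqv :=
    { refl := fun _ => ⟨Equiv.refl _, fun _ => rfl, fun _ => rfl, rfl, fun _ => Iff.rfl⟩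
      symm := by
        rintro M N ⟨e, h1, h2, h3, h4⟩
        refine ⟨e.symm, fun d => ?_, fun d => ?_, ?_, fun d => ?_⟩
        · rw [Equiv.symm_apply_eq, h1, Equiv.apply_symm_apply]
        · rw [Equiv.symm_apply_eq, h2, Equiv.apply_symm_apply]
        · rw [Equiv.symm_apply_eq, h3]
        · rw [← h4, Equiv.apply_symm_apply]
      trans := by
        rintro M N P ⟨e, h1, h2, h3, h4⟩ ⟨e', h1', h2', h3', h4'⟩
        exact ⟨e.trans e', fun d => by simp [h1, h1'], fun d => by simp [h2, h2'],
          by simp [h3, h3'], fun d => by simp [h4, h4']⟩ }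

/-! ### Ungluing

The darts of the unglued map are those of the map (`Sum.inl`) and a copy (`Sum.inr s`) of each dart
`s` of the decoration. The copy has the new external face to its left, and its reverse is the old
dart `rev s`. Thus each edge of the decoration is doubled. -/

open Classical in
/-- Reversal of darts in the unglued map. -/
def unglueRev (X : DecoratedMap) : X.map.Dart ⊕ X.decor → X.map.Dart ⊕ X.decor
  | Sum.inl d =>
    if h : d ∈ X.decor then Sum.inr ⟨X.map.rev d, X.rev_mem d h⟩ else Sum.inl (X.map.rev d)
  | Sum.inr s => Sum.inl (X.map.rev s)

theorem unglueRev_involutive (X : DecoratedMap) : Function.Involutive X.unglueRev := by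
  rintro (d | s)
  · by_cases h : d ∈ X.decor
    · simp [unglueRev, h, X.map.rev_rev]
    · have h' : X.map.rev d ∉ X.decor := fun h' => h (by simpa [X.map.rev_rev] using X.rev_mem _ h')
      simp [unglueRev, h, h', X.map.rev_rev]
  · simp [unglueRev, X.map.rev_rev, X.rev_mem s s.2]

theorem unglueRev_ne (X : DecoratedMap) (d : X.map.Dart ⊕ X.decor) : X.unglueRev d ≠ d := by
  rcases d with d | s
  · by_cases h : d ∈ X.decor
    · simp [unglueRev, h]
    · simpa [unglueRev, h] using X.map.rev_ne d
  · simp [unglueRev]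

open Classical in
/-- Clockwise rotation in the unglued map. A vertex of the decoration is split into its corners. In
the corner from `s` clockwise to the next dart `s'` of the decoration the order is: the copy of `s`,
the old darts strictly between `s` and `s'`, the old dart `s'`. Vertices outside of the decoration
are not changed. -/
def unglueRot (X : DecoratedMap) : Equiv.Perm (X.map.Dart ⊕ X.decor) where
  toFun
    | Sum.inl d =>
      if h : d ∈ X.decor then Sum.inr (X.submap.rot.symm ⟨d, h⟩) else Sum.inl (X.map.rot d)
    | Sum.inr s => Sum.inl (X.map.rot s)
  invFun
    | Sum.inl d =>
      if h : X.map.rot.symm d ∈ X.decor then Sum.inr ⟨X.map.rot.symm d, h⟩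
      else Sum.inl (X.map.rot.symm d)
    | Sum.inr s => Sum.inl (X.submap.rot s : X.decor).1
  left_inv := by
    rintro (d | s)
    · by_cases h : d ∈ X.decor
      · simp only [h, dite_true]
        exact congrArg (fun s : X.decor => Sum.inl s.1)
          (Equiv.apply_symm_apply X.submap.rot (⟨d, h⟩ : X.decor))
      · simp [h]
    · simp
  right_inv := by
    rintro (d | s)
    · by_cases h : X.map.rot.symm d ∈ X.decor
      · simp [h]
      · simp [h]
    · have h : (X.submap.rot s : X.decor).1 ∈ X.decor := (X.submap.rot s : X.decor).2
      simp only [h, dite_true]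
      exact congrArg Sum.inr (Equiv.symm_apply_apply X.submap.rot s)

/-- The unglued map, rooted at the copy of the root edge with the external face to its left. -/
def unglue (X : DecoratedMap) : RootedMap where
  Dart := X.map.Dart ⊕ X.decor
  finite := have := X.map.finite; inferInstance
  rot := X.unglueRot
  rev := X.unglueRev_involutive.toPerm
  rev_rev := X.unglueRev_involutive
  rev_ne := X.unglueRev_ne
  root := Sum.inr ⟨X.map.root, X.root_mem⟩

end DecoratedMap

/-! ### Gluing -/

/-- The projection `γ` exhibits `X` as the result of gluing the boundary (of size `2 * m`) of `B`
according to the tree `T` with `m` edges. -/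
structure IsGluingMap (m : ℕ) (T B : RootedMap) (X : DecoratedMap) (γ : B.Dart → X.map.Dart) :
    Prop where
  surjective : Function.Surjective γ
  map_rev : ∀ d, γ (B.rev d) = X.map.rev (γ d)
  map_root : γ B.root = X.map.root
  /-- Two vertices are identified exactly if they are boundary vertices with labels that are
  equivalent under the contour function of the tree. -/
  origin_eq_iff : ∀ d e, X.map.origin (γ d) = X.map.origin (γ e) ↔
    B.origin d = B.origin e ∨ ∃ i < 2 * m, ∃ j < 2 * m, T.ContourEquiv i j ∧
      B.origin d = B.origin (B.boundaryDart i) ∧ B.origin e = B.origin (B.boundaryDart j)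
  /-- Two oriented edges are identified exactly if one of them is a boundary edge, the other one is
  the reverse of a boundary edge, and the identification of the vertices matches them. -/
  eq_iff : ∀ d e, γ d = γ e ↔
    d = e ∨ ∃ i < 2 * m, ∃ j < 2 * m, T.Matched i j ∧
      (d = B.boundaryDart i ∧ e = B.rev (B.boundaryDart j) ∨
        e = B.boundaryDart i ∧ d = B.rev (B.boundaryDart j))
  /-- The cyclic orders are kept, except across the corners of the external face. -/
  map_rot : ∀ d, B.rev d ∉ B.rootFace → X.map.rot (γ d) = γ (B.rot d)
  /-- The decoration is the image of the boundary. -/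
  decor_eq : X.decor = γ '' B.rootFace

/-- `X` is the result of gluing the boundary of `B` according to the tree `T`. -/
def IsGluing (m : ℕ) (T B : RootedMap) (X : DecoratedMap) : Prop :=
  ∃ γ : B.Dart → X.map.Dart, IsGluingMap m T B X γ

/-! ### The sets of maps, up to isomorphism -/

/-- Rooted maps up to isomorphism. -/
abbrev MapClass : Type 1 := Quotient RootedMap.isoSetoid

/-- Decorated rooted maps up to isomorphism. -/
abbrev DecoratedMapClass : Type 1 := Quotient DecoratedMap.isoSetoid

/-- The set of planted plane trees with `m` edges. -/
def PlaneTrees (m : ℕ) : Set MapClass := {c | ∃ M : RootedMap, M.IsPlaneTree m ∧ ⟦M⟧ = c}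

/-- The set of maps with a simple boundary of size `2 * m` and `f` internal faces. -/
def SimpleBoundaryMaps (f m : ℕ) : Set MapClass :=
  {c | ∃ M : RootedMap, M.IsSimpleBoundaryMap f m ∧ ⟦M⟧ = c}

/-- The set of tree-decorated maps with `f` faces and a tree with `m` edges, with the root edge on
the tree. -/
def TreeDecoratedMaps (f m : ℕ) : Set DecoratedMapClass :=
  {c | ∃ X : DecoratedMap, X.IsTreeDecorated f m ∧ ⟦X⟧ = c}

end

/-! Everything is read off from permutations of darts. In the unglued map the face permutation
preserves the two kinds of darts. On old darts it is the face permutation of the original map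
(`faceNext_old`), and on copies it is the contour walk of the tree (`faceNext_copy`). The contour
walk of a map is conjugate to the inverse of its face permutation, so a tree, having one face, has a
single contour cycle. Hence ungluing adds exactly one face, of degree `2 * m`, and boundary label
`i` belongs to the `i`-th contour dart. Every corner of the tree becomes a vertex carrying exactly
one copy (`origin_copy_injective`), so the boundary is simple. Vertices increase by `2m - (m + 1)`,
edges by `m` and faces by `1`, so Euler's relation is preserved in both directions
(`isPlanarMap_unglue_iff`).

The contour function enters through `IsPlaneTree.contourEquiv_iff` and `IsPlaneTree.matched_iff`:
equivalent times are visits to the same vertex, and matched steps are opposite darts. Therefore the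
projection from the unglued map satisfies the description of the gluing (`isGluingMap_proj`).

A gluing is determined up to isomorphism by the tree and the bounded map (`IsGluing.unique`): its
fibres are prescribed, and every dart has a preimage at which the rotation is prescribed. This gives
injectivity of the ungluing. For surjectivity, the contour cycle of `T` and the boundary cycle of
`B` both have length `2m`. Matching them allows the glued map to be built on the darts of `B` off
the root face; its decoration is `T` and its ungluing is `B` (`iso_submap`, `iso_unglue`). -/

/-! ### Cycles of permutations and first returns -/

theorem sameCycle_map_iff {A B : Type*} {p : Equiv.Perm A} {q : Equiv.Perm B} (e : A ≃ B)
    (h : ∀ a, e (p a) = q (e a)) (a b : A) : q.SameCycle (e a) (e b) ↔ p.SameCycle a b := by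
  have hq : q = (e.symm.trans p).trans e := by
    ext x; simp [h]
  have hz : ∀ n : ℤ, ∀ a, (q ^ n) (e a) = e ((p ^ n) a) := by
    intro n
    induction n using Int.induction_on with
    | zero => simp
    | succ n ih => intro a; rw [zpow_add_one, zpow_add_one, Equiv.Perm.mul_apply,
        Equiv.Perm.mul_apply, ← h, ih]
    | pred n ih =>
      intro a
      rw [zpow_sub_one, zpow_sub_one, Equiv.Perm.mul_apply, Equiv.Perm.mul_apply, ← ih]
      congr 1
      rw [Equiv.Perm.inv_eq_iff_eq, ← h]
      simp
  constructor
  · rintro ⟨n, hn⟩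
    exact ⟨n, e.injective (by rw [← hz, hn])⟩
  · rintro ⟨n, hn⟩
    exact ⟨n, by rw [hz, hn]⟩

theorem card_cycles_congr {A B : Type*} {p : Equiv.Perm A} {q : Equiv.Perm B} (e : A ≃ B)
    (h : ∀ a, e (p a) = q (e a)) :
    Nat.card (Quotient (Equiv.Perm.SameCycle.setoid p)) =
      Nat.card (Quotient (Equiv.Perm.SameCycle.setoid q)) :=
  Nat.card_congr (Quotient.congr e fun a b => (sameCycle_map_iff e h a b).symm)

theorem card_cycles_eq_one_iff {A : Type*} (p : Equiv.Perm A) (a : A) :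
    Nat.card (Quotient (Equiv.Perm.SameCycle.setoid p)) = 1 ↔ ∀ b c, p.SameCycle b c := by
  rw [Nat.card_eq_one_iff_unique]
  constructor
  · rintro ⟨h, -⟩ b c
    exact Quotient.exact (s := Equiv.Perm.SameCycle.setoid p) (h.elim _ _)
  · intro h
    refine ⟨⟨?_⟩, ⟨Quotient.mk _ a⟩⟩
    rintro ⟨b⟩ ⟨c⟩
    exact Quotient.sound (h b c)

theorem firstReturn_eq_of {D : Type} (hD : Finite D) (p : Equiv.Perm D) (S : Set D) (d e : S)
    (n : ℕ) (hn : (p ^ (n + 1)) (d : D) = e) (h : ∀ k < n, (p ^ (k + 1)) (d : D) ∉ S) :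
    firstReturn hD p S d = e := by
  classical
  have hf : Nat.find (exists_return hD p S d) = n + 1 := by
    rw [Nat.find_eq_iff]
    refine ⟨⟨Nat.succ_pos n, hn ▸ e.2⟩, ?_⟩
    rintro k hk ⟨hk0, hkS⟩
    obtain ⟨k, rfl⟩ := Nat.exists_eq_succ_of_ne_zero hk0.ne'
    exact h k (by omega) hkS
  apply Subtype.ext
  simp only [firstReturn]
  rw [← hn, ← hf]

theorem firstReturn_spec {D : Type} (hD : Finite D) (p : Equiv.Perm D) (S : Set D) (d : S) :
    ∃ n : ℕ, (p ^ (n + 1)) (d : D) = firstReturn hD p S d ∧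
      ∀ k < n, (p ^ (k + 1)) (d : D) ∉ S := by
  classical
  have h := (Nat.find_spec (exists_return hD p S d))
  obtain ⟨n, hn⟩ := Nat.exists_eq_succ_of_ne_zero h.1.ne'
  refine ⟨n, ?_, fun k hk hS => ?_⟩
  · simp only [firstReturn]
    rw [hn]
  · exact Nat.find_min (exists_return hD p S d) (m := k + 1) (by omega) ⟨Nat.succ_pos k, hS⟩

theorem firstReturnPerm_apply {D : Type} (hD : Finite D) (p : Equiv.Perm D) (S : Set D) (d : S) :
    firstReturnPerm hD p S d = firstReturn hD p S d := rfl

/-- A first return is a power of `p`. Conversely, a power of `p` leading from `d` to `e` in `S`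
cannot be shorter than the first return from `d`, so it splits off one step of the induced
permutation and a smaller exponent remains. -/
theorem firstReturnPerm_sameCycle_iff {D : Type} (hD : Finite D) (p : Equiv.Perm D) (S : Set D)
    (d e : S) : (firstReturnPerm hD p S).SameCycle d e ↔ p.SameCycle (d : D) e := by
  have step : ∀ d : S, p.SameCycle (d : D) (firstReturnPerm hD p S d : S) := by
    intro d
    obtain ⟨n, hn, -⟩ := firstReturn_spec hD p S d
    exact ⟨n + 1, by rw [firstReturnPerm_apply, ← hn]; rfl⟩
  have pows : ∀ (n : ℕ) (d : S), p.SameCycle (d : D) ((firstReturnPerm hD p S ^ n) d : S) := by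
    intro n
    induction n with
    | zero => intro d; exact Equiv.Perm.SameCycle.refl _ _
    | succ n ih => intro d; rw [pow_succ']; exact (ih d).trans (step _)
  constructor
  · intro h
    obtain ⟨n, rfl⟩ := h.exists_nat_pow_eq
    exact pows n d
  · intro h
    obtain ⟨n, hn⟩ := h.exists_nat_pow_eq
    induction n using Nat.strong_induction_on generalizing d with
    | _ n ih =>
      rcases Nat.eq_zero_or_pos n with rfl | hpos
      · exact (Subtype.ext (by simpa using hn) : d = e) ▸ Equiv.Perm.SameCycle.refl _ _
      · obtain ⟨l, hl, hmin⟩ := firstReturn_spec hD p S d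
        have hle : l + 1 ≤ n := by
          by_contra hlt
          obtain ⟨k, rfl⟩ := Nat.exists_eq_succ_of_ne_zero hpos.ne'
          exact hmin k (by omega) (hn ▸ e.2)
        have h2 := ih (n - (l + 1)) (by omega) (firstReturnPerm hD p S d)
          ((step d).symm.trans h) (by
            rw [firstReturnPerm_apply, ← hl, ← Equiv.Perm.mul_apply, ← pow_add,
              Nat.sub_add_cancel hle, hn])
        exact Equiv.Perm.sameCycle_apply_left.1 h2

/-! ### Darts, edges and connectedness of rooted maps -/

namespace RootedMap

instance (M : RootedMap) : Finite M.Dart := M.finite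
instance (M : RootedMap) : Finite M.Vertex := inferInstanceAs (Finite (Quotient _))
instance (M : RootedMap) : Finite M.Edge := inferInstanceAs (Finite (Quotient _))
instance (M : RootedMap) : Finite M.Face := inferInstanceAs (Finite (Quotient _))

theorem origin_eq_iff_sameCycle (M : RootedMap) {d e : M.Dart} :
    M.origin d = M.origin e ↔ M.rot.SameCycle d e :=
  Quotient.eq (r := Equiv.Perm.SameCycle.setoid M.rot)

theorem origin_surjective (M : RootedMap) : Function.Surjective M.origin :=
  Quotient.mk_surjective

theorem origin_rot (M : RootedMap) (d : M.Dart) : M.origin (M.rot d) = M.origin d :=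
  M.origin_eq_iff_sameCycle.2 (Equiv.Perm.sameCycle_apply_left.2 (Equiv.Perm.SameCycle.refl _ _))

theorem origin_rot_pow (M : RootedMap) (n : ℕ) (d : M.Dart) :
    M.origin ((M.rot ^ n) d) = M.origin d :=
  M.origin_eq_iff_sameCycle.2 (Equiv.Perm.sameCycle_pow_left.2 (Equiv.Perm.SameCycle.refl _ _))

theorem rev_sameCycle_iff (M : RootedMap) {d e : M.Dart} :
    M.rev.SameCycle d e ↔ e = d ∨ e = M.rev d := by
  constructor
  · intro h
    obtain ⟨n, rfl⟩ := h.exists_nat_pow_eq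
    induction n with
    | zero => simp
    | succ n ih =>
      rw [pow_succ', Equiv.Perm.mul_apply]
      rcases ih (Equiv.Perm.sameCycle_pow_right.2 (Equiv.Perm.SameCycle.refl _ _)) with h | h
      · rw [h]; simp
      · rw [h, M.rev_rev]; simp
  · rintro (rfl | rfl)
    · exact Equiv.Perm.SameCycle.refl _ _
    · exact Equiv.Perm.sameCycle_apply_right.2 (Equiv.Perm.SameCycle.refl _ _)

theorem rev_inv (M : RootedMap) : M.rev⁻¹ = M.rev := by
  ext d
  rw [Equiv.Perm.inv_eq_iff_eq, M.rev_rev]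

theorem card_dart (M : RootedMap) : Nat.card M.Dart = 2 * Nat.card M.Edge := by
  classical
  have := Fintype.ofFinite M.Dart
  have := Fintype.ofFinite M.Edge
  let q : M.Dart → M.Edge := Quotient.mk (Equiv.Perm.SameCycle.setoid M.rev)
  rw [Nat.card_eq_fintype_card, Nat.card_eq_fintype_card, ← Finset.card_univ,
    Finset.card_eq_sum_card_fiberwise (f := q) (t := Finset.univ) (by intro _ _; simp)]
  have : ∀ x : M.Edge, (Finset.univ.filter fun d => q d = x).card = 2 := by
    intro x
    obtain ⟨d, rfl⟩ := Quotient.exists_rep x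
    have : (Finset.univ.filter fun e => q e = q d) = {d, M.rev d} := by
      ext e
      simp only [Finset.mem_filter, Finset.mem_univ, true_and, Finset.mem_insert,
        Finset.mem_singleton]
      rw [eq_comm]
      exact (Quotient.eq (r := Equiv.Perm.SameCycle.setoid M.rev)).trans M.rev_sameCycle_iff
    exact (congrArg Finset.card this).trans (Finset.card_pair (M.rev_ne d).symm)
  rw [Finset.sum_congr rfl fun x _ => this x]
  simp [mul_comm]

/-- Being reachable from `d` is itself an invariant property, and invariance under the generators
extends to the generated group. This form transfers connectedness between maps whose permutations
are not conjugate. -/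
theorem connected_iff (M : RootedMap) :
    M.Connected ↔ ∀ P : M.Dart → Prop, (∀ d, P (M.rot d) ↔ P d) → (∀ d, P (M.rev d) ↔ P d) →
      ∀ d e, P d → P e := by
  constructor
  · intro h P h1 h2 d e hd
    obtain ⟨g, hg, rfl⟩ := h d e
    have : ∀ d, P (g d) ↔ P d := by
      induction hg using Subgroup.closure_induction with
      | mem x hx =>
        rcases hx with rfl | hx
        · exact h1
        · rw [Set.mem_singleton_iff] at hx
          rw [hx]; exact h2
      | one => simp
      | mul x y _ _ hx hy => intro d; rw [Equiv.Perm.mul_apply, hx, hy]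
      | inv x _ hx => intro d; rw [← hx]; simp
    exact (this d).2 hd
  · intro h d e
    have key : ∀ r ∈ Subgroup.closure {M.rot, M.rev}, ∀ x,
        (∃ g ∈ Subgroup.closure {M.rot, M.rev}, g d = r x) ↔
          ∃ g ∈ Subgroup.closure {M.rot, M.rev}, g d = x := by
      intro r hr x
      constructor
      · rintro ⟨g, hg, hx⟩
        exact ⟨r⁻¹ * g, mul_mem (inv_mem hr) hg, by simp [hx]⟩
      · rintro ⟨g, hg, rfl⟩
        exact ⟨r * g, mul_mem hr hg, rfl⟩
    exact h (fun x => ∃ g ∈ Subgroup.closure {M.rot, M.rev}, g d = x)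
      (key _ (Subgroup.subset_closure (by simp))) (key _ (Subgroup.subset_closure (by simp)))
      d e ⟨1, one_mem _, rfl⟩

/-! ### Invariance under isomorphism -/

section Iso

variable {M N : RootedMap}

theorem map_faceNext (e : M.Dart ≃ N.Dart)
    (hrot : ∀ d, e (M.rot d) = N.rot (e d))
    (hrev : ∀ d, e (M.rev d) = N.rev (e d))
    (d : M.Dart) : e (M.faceNext d) = N.faceNext (e d) := by
  simp [faceNext, hrot, hrev]

theorem Connected.map (e : M.Dart ≃ N.Dart)
    (hrot : ∀ d, e (M.rot d) = N.rot (e d))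
    (hrev : ∀ d, e (M.rev d) = N.rev (e d))
    (h : M.Connected) : N.Connected := by
  rw [connected_iff] at h ⊢
  intro P h1 h2 d d' hd
  have := h (fun x => P (e x)) (fun x => by rw [hrot, h1]) (fun x => by rw [hrev, h2])
    (e.symm d) (e.symm d') (by simpa using hd)
  simpa using this

theorem map_origin_eq_iff (e : M.Dart ≃ N.Dart)
    (hrot : ∀ d, e (M.rot d) = N.rot (e d))
    (d d' : M.Dart) :
    N.origin (e d) = N.origin (e d') ↔ M.origin d = M.origin d' := by
  rw [origin_eq_iff_sameCycle, origin_eq_iff_sameCycle, sameCycle_map_iff e hrot]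

theorem map_mem_rootFace (e : M.Dart ≃ N.Dart)
    (hrot : ∀ d, e (M.rot d) = N.rot (e d))
    (hrev : ∀ d, e (M.rev d) = N.rev (e d))
    (hroot : e M.root = N.root)
    (d : M.Dart) : e d ∈ N.rootFace ↔ d ∈ M.rootFace := by
  change N.faceNext.SameCycle N.root (e d) ↔ M.faceNext.SameCycle M.root d
  rw [← hroot, sameCycle_map_iff e (map_faceNext e hrot hrev)]

theorem map_boundaryDart (e : M.Dart ≃ N.Dart)
    (hrot : ∀ d, e (M.rot d) = N.rot (e d))
    (hrev : ∀ d, e (M.rev d) = N.rev (e d))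
    (hroot : e M.root = N.root)
    (n : ℕ) : e (M.boundaryDart n) = N.boundaryDart n := by
  induction n with
  | zero => exact hroot
  | succ n ih =>
    simp only [boundaryDart, pow_succ', Equiv.Perm.mul_apply] at ih ⊢
    rw [map_faceNext e hrot hrev, ih]

theorem map_contourDart (e : M.Dart ≃ N.Dart)
    (hrot : ∀ d, e (M.rot d) = N.rot (e d))
    (hrev : ∀ d, e (M.rev d) = N.rev (e d))
    (hroot : e M.root = N.root)
    (n : ℕ) : e (M.contourDart n) = N.contourDart n := by
  induction n with
  | zero => exact hroot
  | succ n ih =>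
    simp only [contourDart, pow_succ', Equiv.Perm.mul_apply] at ih ⊢
    rw [← ih, ← hrev, Equiv.Perm.eq_inv_iff_eq, ← hrot]
    simp

end Iso

theorem Iso.card_vertex {M N : RootedMap} (h : Iso M N) :
    Nat.card M.Vertex = Nat.card N.Vertex := by
  obtain ⟨e, h1, -, -⟩ := h
  exact card_cycles_congr e h1

theorem Iso.card_edge {M N : RootedMap} (h : Iso M N) :
    Nat.card M.Edge = Nat.card N.Edge := by
  obtain ⟨e, -, h2, -⟩ := h
  exact card_cycles_congr e h2

theorem Iso.card_face {M N : RootedMap} (h : Iso M N) :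
    Nat.card M.Face = Nat.card N.Face := by
  obtain ⟨e, h1, h2, -⟩ := h
  exact card_cycles_congr e (map_faceNext e h1 h2)

theorem Iso.isPlanarMap {M N : RootedMap} (h : Iso M N) (hM : M.IsPlanarMap) :
    N.IsPlanarMap := by
  refine ⟨?_, by rw [← h.card_vertex, ← h.card_edge, ← h.card_face]; exact hM.2⟩
  obtain ⟨e, h1, h2, -⟩ := h
  exact hM.1.map e h1 h2

theorem Iso.isPlaneTree {M N : RootedMap} {m : ℕ} (h : Iso M N) (hM : M.IsPlaneTree m) :
    N.IsPlaneTree m :=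
  ⟨h.isPlanarMap hM.1, h.card_face ▸ hM.2.1, h.card_edge ▸ hM.2.2⟩

theorem _root_.SimpleGraph.Iso.dist_apply {V W : Type*} {G : SimpleGraph V} {H : SimpleGraph W}
    (φ : G ≃g H) (u v : V) : H.dist (φ u) (φ v) = G.dist u v := by
  rw [SimpleGraph.dist_eq_sInf, SimpleGraph.dist_eq_sInf]
  congr 1
  ext n
  constructor
  · rintro ⟨p, rfl⟩
    exact ⟨(p.map φ.symm.toHom).copy (φ.symm_apply_apply u) (φ.symm_apply_apply v), by simp⟩
  · rintro ⟨p, rfl⟩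
    exact ⟨p.map φ.toHom, by simp⟩

theorem Iso.contour_eq {M N : RootedMap} (h : Iso M N) : M.contour = N.contour := by
  obtain ⟨e, h1, h2, h3⟩ := h
  let φ : M.Vertex ≃ N.Vertex := Quotient.congr e fun a b => (sameCycle_map_iff e h1 a b).symm
  have hφ : ∀ d, φ (M.origin d) = N.origin (e d) := fun d => rfl
  have hends : ∀ u v, (∃ d, N.origin d = φ u ∧ N.origin (N.rev d) = φ v) ↔
      ∃ d, M.origin d = u ∧ M.origin (M.rev d) = v := by
    intro u v
    rw [← e.exists_congr_right]
    simp only [← h2, ← hφ, φ.apply_eq_iff_eq]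
  let ψ : M.graph ≃g N.graph := ⟨φ, by
    intro u v
    simp only [graph, SimpleGraph.fromRel_adj, hends, ne_eq, φ.apply_eq_iff_eq]⟩
  funext n
  have hv : ∀ d, ψ (M.origin d) = N.origin (e d) := hφ
  rw [contour, contour, ← ψ.dist_apply, hv, hv, h3, map_contourDart e h1 h2 h3]

end RootedMap

/-! ### Distances and ancestors in trees -/

/-- Geodesics to `u` and to `v`, each prolonged by an edge to `w`, are both paths from `r` to `w`;
paths in a tree are unique, so the last steps agree. -/
theorem SimpleGraph.IsTree.eq_of_adj_of_dist_add_one {V : Type*} {G : SimpleGraph V}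
    (hG : G.IsTree) (r : V) {u v w : V} (hu : G.Adj u w) (hv : G.Adj v w)
    (hdu : G.dist r w = G.dist r u + 1) (hdv : G.dist r w = G.dist r v + 1) : u = v := by
  obtain ⟨p, hp⟩ := hG.connected.exists_walk_length_eq_dist r u
  obtain ⟨q, hq⟩ := hG.connected.exists_walk_length_eq_dist r v
  have h1 : (p.concat hu).IsPath :=
    SimpleGraph.Walk.isPath_of_length_eq_dist _ (by rw [SimpleGraph.Walk.length_concat, hp, hdu])
  have h2 : (q.concat hv).IsPath :=
    SimpleGraph.Walk.isPath_of_length_eq_dist _ (by rw [SimpleGraph.Walk.length_concat, hq, hdv])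
  exact (SimpleGraph.Walk.concat_inj ((hG.existsUnique_path r w).unique h1 h2)).1

/-- In a rooted forest, a walk that stays at height at least `h` keeps its ancestor at height
`h`. -/
theorem iterate_parent_eq {V : Type*} (H : V → ℕ) (par : V → V) (v : ℕ → V)
    (hstep : ∀ n, (H (v (n + 1)) = H (v n) + 1 ∧ par (v (n + 1)) = v n) ∨
      (H (v n) = H (v (n + 1)) + 1 ∧ par (v n) = v (n + 1)))
    {h i j : ℕ} (hij : i ≤ j) (hk : ∀ k, i ≤ k → k ≤ j → h ≤ H (v k)) :
    par^[H (v i) - h] (v i) = par^[H (v j) - h] (v j) := by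
  induction j, hij using Nat.le_induction with
  | base => rfl
  | succ j hij ih =>
    rw [ih fun k h1 h2 => hk k h1 (by omega)]
    have h1 := hk j hij (by omega)
    have h2 := hk (j + 1) (by omega) le_rfl
    rcases hstep j with ⟨h3, h4⟩ | ⟨h3, h4⟩
    · rw [show H (v (j + 1)) - h = (H (v j) - h) + 1 by omega, Function.iterate_succ_apply, h4]
    · rw [show H (v j) - h = (H (v (j + 1)) - h) + 1 by omega, Function.iterate_succ_apply, h4]

namespace RootedMap

/-! ### Trees -/

/-- The next dart of the contour walk. -/
def contourNext (M : RootedMap) : Equiv.Perm M.Dart := M.rot⁻¹ * M.rev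

/-- Reversal conjugates the contour step to the inverse of `faceNext`: following a tree with the
left hand traverses its face backwards along reversed darts. -/
theorem contourNext_sameCycle_iff (M : RootedMap) {d e : M.Dart} :
    M.contourNext.SameCycle d e ↔ M.faceNext.SameCycle (M.rev d) (M.rev e) := by
  have h : M.contourNext = M.rev * M.faceNext⁻¹ * M.rev⁻¹ := by
    rw [faceNext, mul_inv_rev, M.rev_inv, contourNext, ← mul_assoc]
    congr 1
    ext d
    simp [M.rev_rev]
  rw [h, Equiv.Perm.sameCycle_conj, Equiv.Perm.sameCycle_inv, M.rev_inv]

theorem contourDart_succ (M : RootedMap) (n : ℕ) :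
    M.contourDart (n + 1) = M.rot⁻¹ (M.rev (M.contourDart n)) := by
  simp only [contourDart, pow_succ', Equiv.Perm.mul_apply]

theorem origin_contourDart_succ (M : RootedMap) (n : ℕ) :
    M.origin (M.contourDart (n + 1)) = M.origin (M.rev (M.contourDart n)) := by
  rw [contourDart_succ, ← M.origin_rot]
  simp

section Tree

variable {T : RootedMap} {m : ℕ}

theorem IsPlaneTree.contourNext_sameCycle (hT : T.IsPlaneTree m) (d e : T.Dart) :
    T.contourNext.SameCycle d e :=
  T.contourNext_sameCycle_iff.2 ((card_cycles_eq_one_iff T.faceNext T.root).1 hT.2.1 _ _)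

theorem IsPlaneTree.card_dart (hT : T.IsPlaneTree m) : Nat.card T.Dart = 2 * m := by
  rw [T.card_dart, hT.2.2]

theorem IsPlaneTree.card_vertex (hT : T.IsPlaneTree m) : Nat.card T.Vertex = m + 1 := by
  have := hT.1.2
  rw [hT.2.1, hT.2.2] at this
  omega

theorem IsPlaneTree.isCycleOn (hT : T.IsPlaneTree m) :
    T.contourNext.IsCycleOn Set.univ :=
  ⟨Set.bijOn_univ.2 T.contourNext.bijective, fun x _ y _ => hT.contourNext_sameCycle x y⟩

theorem IsPlaneTree.contourDart_eq_iff (hT : T.IsPlaneTree m) (i j : ℕ) :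
    T.contourDart i = T.contourDart j ↔ i ≡ j [MOD 2 * m] := by
  classical
  have := Fintype.ofFinite T.Dart
  have h : T.contourNext.IsCycleOn ((Finset.univ : Finset T.Dart) : Set T.Dart) := by
    simpa using hT.isCycleOn
  have h2 := h.pow_apply_eq_pow_apply (Finset.mem_univ T.root) (m := i) (n := j)
  rw [Finset.card_univ, ← Nat.card_eq_fintype_card, hT.card_dart] at h2
  exact h2

theorem IsPlaneTree.exists_contourDart (hT : T.IsPlaneTree m) (d : T.Dart) :
    ∃ i < 2 * m, T.contourDart i = d := by
  classical
  have := Fintype.ofFinite T.Dart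
  have h : T.contourNext.IsCycleOn ((Finset.univ : Finset T.Dart) : Set T.Dart) := by
    simpa using hT.isCycleOn
  have h2 := h.exists_pow_eq (Finset.mem_univ T.root) (Finset.mem_univ d)
  rw [Finset.card_univ, ← Nat.card_eq_fintype_card, hT.card_dart] at h2
  exact h2

theorem IsPlaneTree.contourDart_injOn (hT : T.IsPlaneTree m) {i j : ℕ} (hi : i < 2 * m)
    (hj : j < 2 * m) (h : T.contourDart i = T.contourDart j) : i = j :=
  ((hT.contourDart_eq_iff i j).1 h).eq_of_lt_of_lt hi hj

/-- The end points of an edge. -/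
def ends (T : RootedMap) : T.Edge → Sym2 T.Vertex :=
  Quotient.lift (fun d => s(T.origin d, T.origin (T.rev d))) (by
    intro d e h
    rcases T.rev_sameCycle_iff.1 h with rfl | rfl
    · rfl
    · simp only [T.rev_rev]
      exact Sym2.eq_swap)

theorem graph_connected (h : T.Connected) : T.graph.Connected := by
  have : Nonempty T.Vertex := ⟨T.origin T.root⟩
  refine ⟨fun u v => ?_⟩
  obtain ⟨d, rfl⟩ := T.origin_surjective u
  obtain ⟨e, rfl⟩ := T.origin_surjective v
  refine T.connected_iff.1 h (fun x => T.graph.Reachable (T.origin d) (T.origin x))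
    (fun x => by rw [T.origin_rot]) (fun x => ?_) d e (SimpleGraph.Reachable.refl _)
  have hx : T.graph.Reachable (T.origin x) (T.origin (T.rev x)) := by
    by_cases hne : T.origin x = T.origin (T.rev x)
    · rw [← hne]
    · exact SimpleGraph.Adj.reachable
        ((SimpleGraph.fromRel_adj _ _ _).2 ⟨hne, Or.inl ⟨x, rfl, rfl⟩⟩)
  exact ⟨fun h => h.trans hx.symm, fun h => h.trans hx⟩

theorem edgeSet_subset_range_ends (T : RootedMap) : T.graph.edgeSet ⊆ Set.range T.ends := by
  intro x
  induction x using Sym2.ind with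
  | _ u v =>
    intro h
    have hadj : T.graph.Adj u v := h
    obtain ⟨-, ⟨d, rfl, rfl⟩ | ⟨d, rfl, rfl⟩⟩ := (SimpleGraph.fromRel_adj _ _ _).1 hadj
    · exact ⟨Quotient.mk _ d, rfl⟩
    · exact ⟨Quotient.mk _ d, Sym2.eq_swap⟩

/-- Forgetting loops and multiplicities can only lose edges, which gives at most `m`; connectedness
on `m + 1` vertices, the number given by Euler's relation, requires at least `m`. Equality later
excludes loops and multiple edges. -/
theorem IsPlaneTree.card_edgeSet (hT : T.IsPlaneTree m) : Nat.card T.graph.edgeSet = m := by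
  apply le_antisymm
  · calc Nat.card T.graph.edgeSet ≤ Nat.card (Set.range T.ends) :=
          Nat.card_mono (Set.toFinite _) T.edgeSet_subset_range_ends
      _ ≤ Nat.card T.Edge := Finite.card_range_le _
      _ = m := hT.2.2
  · have := (graph_connected hT.1.1).card_vert_le_card_edgeSet_add_one
    rw [hT.card_vertex] at this
    omega

theorem IsPlaneTree.isTree (hT : T.IsPlaneTree m) : T.graph.IsTree :=
  SimpleGraph.isTree_iff_connected_and_card.2
    ⟨graph_connected hT.1.1, by rw [hT.card_edgeSet, hT.card_vertex]⟩

theorem IsPlaneTree.range_ends (hT : T.IsPlaneTree m) : Set.range T.ends = T.graph.edgeSet := by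
  refine (Set.eq_of_subset_of_ncard_le T.edgeSet_subset_range_ends ?_ (Set.toFinite _)).symm
  rw [← Nat.card_coe_set_eq, ← Nat.card_coe_set_eq, hT.card_edgeSet]
  exact (Finite.card_range_le _).trans hT.2.2.le

theorem IsPlaneTree.ends_injective (hT : T.IsPlaneTree m) : Function.Injective T.ends := by
  have h1 : Function.Bijective (Set.rangeFactorization T.ends) := by
    refine (Nat.bijective_iff_surjective_and_card _).2 ⟨Set.rangeFactorization_surjective, ?_⟩
    rw [hT.2.2, hT.range_ends, hT.card_edgeSet]
  intro a b h
  exact h1.1 (Subtype.ext h)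

theorem IsPlaneTree.adj (hT : T.IsPlaneTree m) (d : T.Dart) :
    T.graph.Adj (T.origin d) (T.origin (T.rev d)) := by
  have : T.ends (Quotient.mk _ d) ∈ T.graph.edgeSet := hT.range_ends ▸ Set.mem_range_self _
  exact this

/-- A dart of a tree is determined by its end points. -/
theorem IsPlaneTree.dart_eq (hT : T.IsPlaneTree m) {d e : T.Dart}
    (h1 : T.origin d = T.origin e) (h2 : T.origin (T.rev d) = T.origin (T.rev e)) : d = e := by
  have h : T.ends (Quotient.mk _ d) = T.ends (Quotient.mk _ e) := by
    change s(T.origin d, T.origin (T.rev d)) = s(T.origin e, T.origin (T.rev e))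
    rw [h1, h2]
  have h3 := Quotient.exact (hT.ends_injective h)
  rcases T.rev_sameCycle_iff.1 h3 with h4 | h4
  · exact h4.symm
  · subst h4
    exact absurd h1 (hT.adj d).ne

/-! ### The contour function of a tree -/

theorem contour_zero (T : RootedMap) : T.contour 0 = 0 := by
  simp [contour, contourDart]

open Classical in
/-- The neighbour of a vertex that is closer to the root. -/
noncomputable def parent (T : RootedMap) (w : T.Vertex) : T.Vertex :=
  if h : ∃ u, T.graph.Adj u w ∧
      T.graph.dist (T.origin T.root) w = T.graph.dist (T.origin T.root) u + 1
  then h.choose else w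

theorem IsPlaneTree.parent_eq (hT : T.IsPlaneTree m) {u w : T.Vertex} (h : T.graph.Adj u w)
    (hd : T.graph.dist (T.origin T.root) w = T.graph.dist (T.origin T.root) u + 1) :
    T.parent w = u := by
  have hex : ∃ u, T.graph.Adj u w ∧
      T.graph.dist (T.origin T.root) w = T.graph.dist (T.origin T.root) u + 1 := ⟨u, h, hd⟩
  rw [parent, dif_pos hex]
  exact hT.isTree.eq_of_adj_of_dist_add_one _ hex.choose_spec.1 h hex.choose_spec.2 hd

theorem IsPlaneTree.contour_step (hT : T.IsPlaneTree m) (n : ℕ) :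
    (T.contour (n + 1) = T.contour n + 1 ∧
      T.parent (T.origin (T.contourDart (n + 1))) = T.origin (T.contourDart n)) ∨
    (T.contour n = T.contour (n + 1) + 1 ∧
      T.parent (T.origin (T.contourDart n)) = T.origin (T.contourDart (n + 1))) := by
  have hadj := hT.adj (T.contourDart n)
  rw [← T.origin_contourDart_succ] at hadj
  rcases hT.isTree.dist_eq_dist_add_one_of_adj (T.origin T.root) hadj with h | h
  · exact Or.inr ⟨h, hT.parent_eq hadj.symm h⟩
  · exact Or.inl ⟨h, hT.parent_eq hadj h⟩

theorem IsPlaneTree.iterate_parent_contour (hT : T.IsPlaneTree m) {h i j : ℕ} (hij : i ≤ j)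
    (hk : ∀ k, i ≤ k → k ≤ j → h ≤ T.contour k) :
    T.parent^[T.contour i - h] (T.origin (T.contourDart i)) =
      T.parent^[T.contour j - h] (T.origin (T.contourDart j)) :=
  iterate_parent_eq (fun w => T.graph.dist (T.origin T.root) w) T.parent
    (fun n => T.origin (T.contourDart n)) hT.contour_step hij hk

/-- The contour walk can reach a vertex from below only through the dart from its parent. -/
theorem IsPlaneTree.exists_contourDart_from_parent (hT : T.IsPlaneTree m) {k j : ℕ} (hkj : k < j)
    (hlt : T.contour k < T.contour j) :
    ∃ l, k ≤ l ∧ l < j ∧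
      T.origin (T.contourDart l) = T.parent (T.origin (T.contourDart j)) ∧
      T.origin (T.rev (T.contourDart l)) = T.origin (T.contourDart j) := by
  classical
  -- The maximum `l` of `s` is the last time before `j` strictly below the height at `j`. The walk
  -- then steps up and stays at least that high until `j`, so the vertices at times `l + 1` and `j`
  -- have the same ancestor at that height, namely themselves.
  let s := (Finset.Ico k j).filter fun l => T.contour l < T.contour j
  have hs : s.Nonempty := ⟨k, by simp [s, hkj, hlt]⟩
  obtain ⟨hl, hl2⟩ := Finset.mem_filter.1 (s.max'_mem hs)
  set l := s.max' hs with hldef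
  rw [Finset.mem_Ico] at hl
  have hmax : ∀ n, l < n → n ≤ j → T.contour j ≤ T.contour n := by
    intro n hn hnj
    rcases hnj.eq_or_lt with rfl | hnj
    · exact le_rfl
    by_contra hc
    have : n ∈ s := Finset.mem_filter.2 ⟨Finset.mem_Ico.2 ⟨by omega, hnj⟩, by omega⟩
    have := s.le_max' n this
    omega
  have h1 := hmax (l + 1) (by omega) (by omega)
  rcases hT.contour_step l with ⟨h2, h3⟩ | ⟨h2, -⟩
  · have h4 := hT.iterate_parent_contour (h := T.contour j) (i := l + 1) (j := j) (by omega)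
      (fun n hn hnj => hmax n (by omega) hnj)
    rw [show T.contour (l + 1) - T.contour j = 0 by omega, Nat.sub_self] at h4
    simp only [Function.iterate_zero, id] at h4
    exact ⟨l, hl.1, hl.2, by rw [← h4, h3], by rw [← T.origin_contourDart_succ, h4]⟩
  · omega

theorem contourEquiv_comm (T : RootedMap) {i j : ℕ} (h : T.ContourEquiv i j) :
    T.ContourEquiv j i :=
  ⟨h.1.symm, fun k hk => h.1 ▸ h.2 k (Set.uIcc_comm i j ▸ hk)⟩

/-- A walk staying at or above its initial height keeps its ancestor at that height, so ending at
that height means being back at the same vertex. Conversely, a dip between two visits would force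
the dart from the parent to be used twice within one period. The final time `2 * m` is allowed
because `Matched` looks one step ahead. -/
theorem IsPlaneTree.contourEquiv_iff_of_le (hT : T.IsPlaneTree m) {i j : ℕ} (hij : i ≤ j)
    (hj : j ≤ 2 * m) :
    T.ContourEquiv i j ↔ T.origin (T.contourDart i) = T.origin (T.contourDart j) := by
  constructor
  · rintro ⟨h1, h2⟩
    rw [Set.uIcc_of_le hij] at h2
    have := hT.iterate_parent_contour (h := T.contour i) hij fun k hk hk' => h2 k ⟨hk, hk'⟩
    rw [← h1, Nat.sub_self] at this
    exact this
  · intro h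
    have h1 : T.contour i = T.contour j := by rw [contour, contour, h]
    refine ⟨h1, fun k hk => ?_⟩
    rw [Set.uIcc_of_le hij] at hk
    by_contra hlt
    rw [not_le] at hlt
    have hki : i < k := lt_of_le_of_ne hk.1 (by rintro rfl; exact lt_irrefl _ hlt)
    have hkj : k < j := lt_of_le_of_ne hk.2 (by rintro rfl; rw [h1] at hlt; exact lt_irrefl _ hlt)
    have h0 : T.contour 0 < T.contour i := by rw [T.contour_zero]; omega
    have hi0 : 0 < i := Nat.pos_of_ne_zero (by rintro rfl; exact lt_irrefl _ h0)
    -- The dart from the parent is used once before `i`, coming from the root at time `0`, and once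
    -- more between the dip `k` and `j`.
    obtain ⟨a, -, ha, ha1, ha2⟩ := hT.exists_contourDart_from_parent hi0 h0
    obtain ⟨b, hb0, hb, hb1, hb2⟩ := hT.exists_contourDart_from_parent hkj (h1 ▸ hlt)
    have hab : T.contourDart a = T.contourDart b :=
      hT.dart_eq (by rw [ha1, hb1, h]) (by rw [ha2, hb2, h])
    have := hT.contourDart_injOn (by omega) (by omega) hab
    omega

theorem IsPlaneTree.contourEquiv_iff (hT : T.IsPlaneTree m) {i j : ℕ} (hi : i ≤ 2 * m)
    (hj : j ≤ 2 * m) :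
    T.ContourEquiv i j ↔ T.origin (T.contourDart i) = T.origin (T.contourDart j) := by
  rcases le_total i j with h | h
  · exact hT.contourEquiv_iff_of_le h hj
  · rw [eq_comm, ← hT.contourEquiv_iff_of_le h hi]
    exact ⟨T.contourEquiv_comm, T.contourEquiv_comm⟩

theorem IsPlaneTree.matched_iff (hT : T.IsPlaneTree m) {i j : ℕ} (hi : i < 2 * m)
    (hj : j < 2 * m) : T.Matched i j ↔ T.contourDart i = T.rev (T.contourDart j) := by
  rw [Matched, hT.contourEquiv_iff (by omega) (by omega), hT.contourEquiv_iff (by omega) (by omega),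
    T.origin_contourDart_succ, T.origin_contourDart_succ]
  constructor
  · rintro ⟨h1, h2⟩
    exact hT.dart_eq h1 (by rw [T.rev_rev, h2])
  · intro h
    rw [h, T.rev_rev]
    exact ⟨rfl, rfl⟩

end Tree

end RootedMap

namespace DecoratedMap

variable (X : DecoratedMap)

/-! ### The decoration as a submap -/

/-- The inclusion of the decoration. -/
def embed (s : X.submap.Dart) : X.map.Dart := Subtype.val (p := (· ∈ X.decor)) s

theorem embed_injective : Function.Injective X.embed := Subtype.val_injective

theorem embed_mem (s : X.submap.Dart) : X.embed s ∈ X.decor := Subtype.prop (p := (· ∈ X.decor)) s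

variable {X} in
theorem exists_embed_eq {d : X.map.Dart} (h : d ∈ X.decor) : ∃ s, X.embed s = d := ⟨⟨d, h⟩, rfl⟩

theorem embed_rev (s : X.submap.Dart) : X.embed (X.submap.rev s) = X.map.rev (X.embed s) := rfl

theorem embed_rot_spec (s : X.submap.Dart) :
    ∃ n : ℕ, (X.map.rot ^ (n + 1)) (X.embed s) = X.embed (X.submap.rot s) ∧
      ∀ k < n, (X.map.rot ^ (k + 1)) (X.embed s) ∉ X.decor :=
  firstReturn_spec X.map.finite X.map.rot X.decor s

theorem submap_rot_eq_of (s t : X.submap.Dart) (n : ℕ)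
    (hn : (X.map.rot ^ (n + 1)) (X.embed s) = X.embed t)
    (h : ∀ k < n, (X.map.rot ^ (k + 1)) (X.embed s) ∉ X.decor) : X.submap.rot s = t :=
  firstReturn_eq_of X.map.finite X.map.rot X.decor s t n hn h

theorem origin_embed_eq_iff (s t : X.submap.Dart) :
    X.map.origin (X.embed s) = X.map.origin (X.embed t) ↔
      X.submap.origin s = X.submap.origin t := by
  rw [RootedMap.origin_eq_iff_sameCycle, RootedMap.origin_eq_iff_sameCycle]
  exact (firstReturnPerm_sameCycle_iff X.map.finite X.map.rot X.decor s t).symm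

/-! ### The darts of the unglued map -/

/-- A dart of the map as a dart of the unglued map. -/
def old (d : X.map.Dart) : X.unglue.Dart := (Sum.inl d : X.map.Dart ⊕ X.decor)

/-- The copy of a dart of the decoration that bounds the external face. -/
def copy (s : X.submap.Dart) : X.unglue.Dart := (Sum.inr s : X.map.Dart ⊕ X.decor)

/-- The projection from the unglued map. -/
def proj : X.unglue.Dart → X.map.Dart :=
  Sum.elim (α := X.map.Dart) (β := X.decor) id Subtype.val

theorem proj_old (d : X.map.Dart) : X.proj (X.old d) = d := rfl

theorem proj_copy (s : X.submap.Dart) : X.proj (X.copy s) = X.embed s := rfl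

theorem old_injective : Function.Injective X.old := Sum.inl_injective

theorem copy_injective : Function.Injective X.copy := Sum.inr_injective

theorem old_ne_copy (d : X.map.Dart) (s : X.submap.Dart) : X.old d ≠ X.copy s := Sum.inl_ne_inr

theorem old_or_copy (x : X.unglue.Dart) : (∃ d, x = X.old d) ∨ ∃ s, x = X.copy s := by
  rcases x with d | s
  exacts [Or.inl ⟨d, rfl⟩, Or.inr ⟨s, rfl⟩]

theorem unglue_root : X.unglue.root = X.copy X.submap.root := rfl

theorem rev_copy (s : X.submap.Dart) :
    X.unglue.rev (X.copy s) = X.old (X.map.rev (X.embed s)) := rfl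

theorem rev_old_embed (s : X.submap.Dart) :
    X.unglue.rev (X.old (X.embed s)) = X.copy (X.submap.rev s) :=
  dif_pos (X.embed_mem s)

variable {X} in
theorem rev_old {d : X.map.Dart} (h : d ∉ X.decor) :
    X.unglue.rev (X.old d) = X.old (X.map.rev d) :=
  dif_neg h

theorem rot_copy (s : X.submap.Dart) :
    X.unglue.rot (X.copy s) = X.old (X.map.rot (X.embed s)) := rfl

theorem rot_old_embed (s : X.submap.Dart) :
    X.unglue.rot (X.old (X.embed s)) = X.copy (X.submap.rot⁻¹ s) :=
  dif_pos (X.embed_mem s)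

variable {X} in
theorem rot_old {d : X.map.Dart} (h : d ∉ X.decor) :
    X.unglue.rot (X.old d) = X.old (X.map.rot d) :=
  dif_neg h

variable {X} in
theorem rev_mem_decor_iff {d : X.map.Dart} : X.map.rev d ∈ X.decor ↔ d ∈ X.decor :=
  ⟨fun h => X.map.rev_rev d ▸ X.rev_mem _ h, X.rev_mem d⟩

theorem proj_surjective : Function.Surjective X.proj := fun d => ⟨X.old d, rfl⟩

theorem proj_rev (x : X.unglue.Dart) : X.proj (X.unglue.rev x) = X.map.rev (X.proj x) := by
  rcases X.old_or_copy x with ⟨d, rfl⟩ | ⟨s, rfl⟩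
  · by_cases h : d ∈ X.decor
    · obtain ⟨s, rfl⟩ := exists_embed_eq h
      rw [rev_old_embed, proj_copy, embed_rev, proj_old]
    · rw [rev_old h, proj_old, proj_old]
  · rw [rev_copy, proj_old, proj_copy]

/-! ### The faces of the unglued map -/

theorem faceNext_old (d : X.map.Dart) :
    X.unglue.faceNext (X.old d) = X.old (X.map.faceNext d) := by
  simp only [RootedMap.faceNext, Equiv.Perm.mul_apply]
  by_cases h : d ∈ X.decor
  · obtain ⟨s, rfl⟩ := exists_embed_eq h
    rw [rev_old_embed, rot_copy, embed_rev]
  · rw [rev_old h, rot_old (rev_mem_decor_iff.not.2 h)]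

/-- The copy of a tree dart is followed in the external face by the copy of its contour successor,
because rotation at an old tree dart jumps back to the start of its corner, the copy of the
preceding tree dart. -/
theorem faceNext_copy (s : X.submap.Dart) :
    X.unglue.faceNext (X.copy s) = X.copy (X.submap.contourNext s) := by
  simp only [RootedMap.faceNext, RootedMap.contourNext, Equiv.Perm.mul_apply]
  rw [rev_copy, ← embed_rev, rot_old_embed]

theorem faceNext_pow_old (n : ℕ) (d : X.map.Dart) :
    (X.unglue.faceNext ^ n) (X.old d) = X.old ((X.map.faceNext ^ n) d) := by
  induction n with
  | zero => rfl
  | succ n ih => rw [pow_succ', pow_succ', Equiv.Perm.mul_apply, ih, faceNext_old]; rfl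

theorem faceNext_pow_copy (n : ℕ) (s : X.submap.Dart) :
    (X.unglue.faceNext ^ n) (X.copy s) = X.copy ((X.submap.contourNext ^ n) s) := by
  induction n with
  | zero => rfl
  | succ n ih => rw [pow_succ', pow_succ', Equiv.Perm.mul_apply, ih, faceNext_copy]; rfl

theorem boundaryDart_unglue (n : ℕ) : X.unglue.boundaryDart n = X.copy (X.submap.contourDart n) :=
  X.faceNext_pow_copy n X.submap.root

theorem faceNext_sameCycle_old_iff (d e : X.map.Dart) :
    X.unglue.faceNext.SameCycle (X.old d) (X.old e) ↔ X.map.faceNext.SameCycle d e := by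
  constructor
  · intro h
    obtain ⟨n, hn⟩ := h.exists_nat_pow_eq
    rw [faceNext_pow_old] at hn
    exact X.old_injective hn ▸ Equiv.Perm.sameCycle_pow_right.2 (Equiv.Perm.SameCycle.refl _ _)
  · intro h
    obtain ⟨n, rfl⟩ := h.exists_nat_pow_eq
    rw [← faceNext_pow_old]
    exact Equiv.Perm.sameCycle_pow_right.2 (Equiv.Perm.SameCycle.refl _ _)

theorem not_faceNext_sameCycle_old_copy (d : X.map.Dart) (s : X.submap.Dart) :
    ¬ X.unglue.faceNext.SameCycle (X.old d) (X.copy s) := by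
  intro h
  obtain ⟨n, hn⟩ := h.exists_nat_pow_eq
  rw [faceNext_pow_old] at hn
  exact X.old_ne_copy _ _ hn

variable {X} {m f : ℕ}

theorem faceNext_sameCycle_copy (hT : X.submap.IsPlaneTree m) (s t : X.submap.Dart) :
    X.unglue.faceNext.SameCycle (X.copy s) (X.copy t) := by
  obtain ⟨n, rfl⟩ := (hT.contourNext_sameCycle s t).exists_nat_pow_eq
  rw [← faceNext_pow_copy]
  exact Equiv.Perm.sameCycle_pow_right.2 (Equiv.Perm.SameCycle.refl _ _)

theorem rootFace_unglue (hT : X.submap.IsPlaneTree m) : X.unglue.rootFace = Set.range X.copy := by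
  ext x
  rcases X.old_or_copy x with ⟨d, rfl⟩ | ⟨s, rfl⟩
  · exact ⟨fun h => absurd (Equiv.Perm.SameCycle.symm h) (X.not_faceNext_sameCycle_old_copy _ _),
      fun ⟨s, hs⟩ => absurd hs.symm (X.old_ne_copy _ _)⟩
  · simp only [Set.mem_range_self, iff_true]
    exact faceNext_sameCycle_copy hT _ _

theorem card_face_unglue (hT : X.submap.IsPlaneTree m) :
    Nat.card X.unglue.Face = Nat.card X.map.Face + 1 := by
  let F : X.map.Face ⊕ Unit → X.unglue.Face := Sum.elim
    (Quotient.map' X.old fun d e h => (X.faceNext_sameCycle_old_iff d e).2 h)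
    (fun _ => Quotient.mk _ (X.copy X.submap.root))
  have hF : Function.Bijective F := by
    constructor
    · rintro (⟨⟨d⟩⟩ | _) (⟨⟨e⟩⟩ | _) h
      · exact congrArg Sum.inl (Quotient.sound ((X.faceNext_sameCycle_old_iff d e).1
          (Quotient.exact h)))
      · exact absurd (Quotient.exact h) (X.not_faceNext_sameCycle_old_copy _ _)
      · exact absurd (Quotient.exact h.symm) (X.not_faceNext_sameCycle_old_copy _ _)
      · rfl
    · rintro ⟨x⟩
      rcases X.old_or_copy x with ⟨d, rfl⟩ | ⟨s, rfl⟩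
      · exact ⟨Sum.inl (Quotient.mk _ d), rfl⟩
      · exact ⟨Sum.inr (), Quotient.sound (faceNext_sameCycle_copy hT _ _)⟩
  rw [← Nat.card_eq_of_bijective F hF, Nat.card_sum, Nat.card_unique (α := Unit)]

theorem card_edge_unglue (hT : X.submap.IsPlaneTree m) :
    Nat.card X.unglue.Edge = Nat.card X.map.Edge + m := by
  have h1 := X.unglue.card_dart
  have h2 := X.map.card_dart
  have h3 : Nat.card X.unglue.Dart = Nat.card X.map.Dart + Nat.card X.submap.Dart :=
    Nat.card_sum (α := X.map.Dart) (β := X.submap.Dart)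
  rw [hT.card_dart] at h3
  omega

/-! ### The vertices of the unglued map -/

theorem origin_proj_rot (x : X.unglue.Dart) :
    X.map.origin (X.proj (X.unglue.rot x)) = X.map.origin (X.proj x) := by
  rcases X.old_or_copy x with ⟨d, rfl⟩ | ⟨s, rfl⟩
  · by_cases h : d ∈ X.decor
    · obtain ⟨s, rfl⟩ := exists_embed_eq h
      rw [rot_old_embed, proj_copy, proj_old, origin_embed_eq_iff, ← X.submap.origin_rot]
      simp
    · rw [rot_old h, proj_old, proj_old, RootedMap.origin_rot]
  · rw [rot_copy, proj_old, proj_copy, RootedMap.origin_rot]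

theorem origin_proj_eq {x y : X.unglue.Dart} (h : X.unglue.origin x = X.unglue.origin y) :
    X.map.origin (X.proj x) = X.map.origin (X.proj y) := by
  obtain ⟨n, rfl⟩ := (X.unglue.origin_eq_iff_sameCycle.1 h).exists_nat_pow_eq
  clear h
  induction n with
  | zero => rfl
  | succ n ih => rw [pow_succ', Equiv.Perm.mul_apply, origin_proj_rot, ih]

/-- Rotating from `d` agrees with the rotation of the original map until a tree dart is met, and the
next rotation lands on a copy. -/
theorem exists_copy_of_origin_eq {d : X.map.Dart} {t : X.submap.Dart}
    (h : X.map.origin d = X.map.origin (X.embed t)) :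
    ∃ s, X.unglue.origin (X.old d) = X.unglue.origin (X.copy s) := by
  obtain ⟨n, hn⟩ := (X.map.origin_eq_iff_sameCycle.1 h).exists_nat_pow_eq
  clear h
  induction n generalizing d with
  | zero =>
    obtain rfl : d = X.embed t := hn
    exact ⟨_, by rw [← X.unglue.origin_rot, rot_old_embed]⟩
  | succ n ih =>
    by_cases hd : d ∈ X.decor
    · obtain ⟨s, rfl⟩ := exists_embed_eq hd
      exact ⟨_, by rw [← X.unglue.origin_rot, rot_old_embed]⟩
    · obtain ⟨s, hs⟩ := ih (d := X.map.rot d) (by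
        rw [← Equiv.Perm.mul_apply, ← pow_succ, hn])
      exact ⟨s, by rw [← hs, ← rot_old hd, X.unglue.origin_rot]⟩

/-- The rotation orbit of `copy s` runs through the old darts up to and including the next tree dart
and then returns to `copy s`, so it contains no other copy. -/
theorem origin_copy_injective : Function.Injective fun s => X.unglue.origin (X.copy s) := by
  intro s t h
  obtain ⟨n, hn, hmin⟩ := X.embed_rot_spec s
  have key : ∀ l : ℕ, (X.unglue.rot ^ l) (X.copy s) = X.copy s ∨
      ∃ k ≤ n, (X.unglue.rot ^ l) (X.copy s) = X.old ((X.map.rot ^ (k + 1)) (X.embed s)) := by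
    intro l
    induction l with
    | zero => exact Or.inl rfl
    | succ l ih =>
      rw [pow_succ', Equiv.Perm.mul_apply]
      rcases ih with h | ⟨k, hk, h⟩
      · exact Or.inr ⟨0, Nat.zero_le _, by rw [h, rot_copy]; simp⟩
      · rw [h]
        rcases hk.eq_or_lt with rfl | hk
        · rw [hn, rot_old_embed]
          left
          simp
        · refine Or.inr ⟨k + 1, hk, ?_⟩
          rw [rot_old (hmin k hk), pow_succ' _ (k + 1), Equiv.Perm.mul_apply]
  obtain ⟨l, hl⟩ := (X.unglue.origin_eq_iff_sameCycle.1 h).exists_nat_pow_eq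
  rcases key l with h | ⟨k, -, h⟩
  · exact X.copy_injective (h.symm.trans hl)
  · exact absurd (h.symm.trans hl) (X.old_ne_copy _ _)

theorem origin_old_eq {d e : X.map.Dart} (hd : ∀ s, X.map.origin d ≠ X.map.origin (X.embed s))
    (h : X.map.origin d = X.map.origin e) :
    X.unglue.origin (X.old d) = X.unglue.origin (X.old e) := by
  obtain ⟨n, rfl⟩ := (X.map.origin_eq_iff_sameCycle.1 h).exists_nat_pow_eq
  clear h
  induction n with
  | zero => rfl
  | succ n ih =>
    rw [ih, pow_succ', Equiv.Perm.mul_apply, ← rot_old, X.unglue.origin_rot]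
    intro hmem
    obtain ⟨s, hs⟩ := exists_embed_eq hmem
    exact hd s (by rw [hs, X.map.origin_rot_pow])

theorem exists_copy_of_origin_proj_eq {x : X.unglue.Dart} {t : X.submap.Dart}
    (h : X.map.origin (X.proj x) = X.map.origin (X.embed t)) :
    ∃ s, X.unglue.origin x = X.unglue.origin (X.copy s) := by
  rcases X.old_or_copy x with ⟨d, rfl⟩ | ⟨s, rfl⟩
  · exact exists_copy_of_origin_eq h
  · exact ⟨s, rfl⟩

theorem origin_eq_of_origin_proj_eq {x y : X.unglue.Dart}
    (hx : ∀ s, X.map.origin (X.proj x) ≠ X.map.origin (X.embed s))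
    (h : X.map.origin (X.proj x) = X.map.origin (X.proj y)) :
    X.unglue.origin x = X.unglue.origin y := by
  rcases X.old_or_copy x with ⟨d, rfl⟩ | ⟨s, rfl⟩
  · rcases X.old_or_copy y with ⟨e, rfl⟩ | ⟨s, rfl⟩
    · exact origin_old_eq hx h
    · exact absurd h (hx s)
  · exact absurd rfl (hx s)

theorem origin_proj_eq_iff (x y : X.unglue.Dart) :
    X.map.origin (X.proj x) = X.map.origin (X.proj y) ↔
      X.unglue.origin x = X.unglue.origin y ∨
        ∃ s t, X.submap.origin s = X.submap.origin t ∧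
          X.unglue.origin x = X.unglue.origin (X.copy s) ∧
          X.unglue.origin y = X.unglue.origin (X.copy t) := by
  constructor
  · intro h
    by_cases hx : ∀ s, X.map.origin (X.proj x) ≠ X.map.origin (X.embed s)
    · exact Or.inl (origin_eq_of_origin_proj_eq hx h)
    · push Not at hx
      obtain ⟨r, hr⟩ := hx
      obtain ⟨s, hs⟩ := exists_copy_of_origin_proj_eq hr
      obtain ⟨t, ht⟩ := exists_copy_of_origin_proj_eq (h.symm.trans hr)
      refine Or.inr ⟨s, t, ?_, hs, ht⟩
      rw [← origin_embed_eq_iff, ← proj_copy, ← proj_copy, ← origin_proj_eq hs,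
        ← origin_proj_eq ht, h]
  · rintro (h | ⟨s, t, h, hs, ht⟩)
    · exact origin_proj_eq h
    · rw [origin_proj_eq hs, origin_proj_eq ht, proj_copy, proj_copy, origin_embed_eq_iff, h]

/-- Over the vertices of the tree there is one unglued vertex for each tree dart; over the other
vertices the projection is a bijection. -/
theorem card_vertex_unglue :
    Nat.card X.unglue.Vertex + Nat.card X.submap.Vertex =
      Nat.card X.map.Vertex + Nat.card X.submap.Dart := by
  let π : X.unglue.Vertex → X.map.Vertex := Quotient.lift (fun x => X.map.origin (X.proj x))
    fun x y h => origin_proj_eq (Quotient.sound h)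
  have hπ : ∀ x, π (X.unglue.origin x) = X.map.origin (X.proj x) := fun x => rfl
  let ι : X.submap.Vertex → X.map.Vertex := Quotient.lift (fun s => X.map.origin (X.embed s))
    fun s t h => (X.origin_embed_eq_iff s t).2 (Quotient.sound h)
  have hι : ∀ s, ι (X.submap.origin s) = X.map.origin (X.embed s) := fun s => rfl
  have ιinj : Function.Injective ι := by
    intro u v h
    obtain ⟨s, rfl⟩ := X.submap.origin_surjective u
    obtain ⟨t, rfl⟩ := X.submap.origin_surjective v
    exact (X.origin_embed_eq_iff s t).1 h
  have hW : (Set.range ι).ncard = Nat.card X.submap.Vertex := by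
    rw [← Nat.card_coe_set_eq, Nat.card_range_of_injective ιinj]
  have hpre : π ⁻¹' Set.range ι = Set.range fun s => X.unglue.origin (X.copy s) := by
    ext u
    obtain ⟨x, rfl⟩ := X.unglue.origin_surjective u
    constructor
    · rintro ⟨v, hv⟩
      obtain ⟨t, rfl⟩ := X.submap.origin_surjective v
      rw [hι, hπ] at hv
      obtain ⟨s, hs⟩ := exists_copy_of_origin_proj_eq hv.symm
      exact ⟨s, hs.symm⟩
    · rintro ⟨s, hs⟩
      exact ⟨X.submap.origin s, by rw [← hs, hι, hπ, proj_copy]⟩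
  have hpre' : (π ⁻¹' Set.range ι).ncard = Nat.card X.submap.Dart := by
    rw [hpre, ← Nat.card_coe_set_eq, Nat.card_range_of_injective origin_copy_injective]
  have hcompl : (π ⁻¹' Set.range ι)ᶜ.ncard = (Set.range ι)ᶜ.ncard := by
    have hsurj : Function.Surjective π := by
      intro v
      obtain ⟨d, rfl⟩ := X.map.origin_surjective v
      exact ⟨X.unglue.origin (X.old d), rfl⟩
    rw [← Set.preimage_compl]
    conv_rhs => rw [← Set.image_preimage_eq (Set.range ι)ᶜ hsurj]
    refine (Set.InjOn.ncard_image ?_).symm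
    intro u hu v _ huv
    obtain ⟨x, rfl⟩ := X.unglue.origin_surjective u
    obtain ⟨y, rfl⟩ := X.unglue.origin_surjective v
    exact origin_eq_of_origin_proj_eq (fun s hs => hu ⟨X.submap.origin s, hs.symm⟩) huv
  have h1 := Set.ncard_add_ncard_compl (π ⁻¹' Set.range ι)
  have h2 := Set.ncard_add_ncard_compl (Set.range ι)
  omega

/-! ### Planarity of the unglued map -/

/-- An invariant property of the map pulls back along `proj`. Conversely, an invariant property of
the unglued map is constant on the copies, as they form one face, and each old tree dart shares a
vertex with a copy, so the property restricts to an invariant one on old darts. -/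
theorem connected_unglue_iff (hT : X.submap.IsPlaneTree m) :
    X.unglue.Connected ↔ X.map.Connected := by
  rw [RootedMap.connected_iff, RootedMap.connected_iff]
  constructor
  · intro h P h1 h2 d e hd
    have horig : ∀ {d e}, X.map.origin d = X.map.origin e → (P d ↔ P e) := by
      intro d e hde
      obtain ⟨n, rfl⟩ := (X.map.origin_eq_iff_sameCycle.1 hde).exists_nat_pow_eq
      clear hde
      induction n with
      | zero => rfl
      | succ n ih => rw [ih, pow_succ', Equiv.Perm.mul_apply, h1]
    exact h (fun x => P (X.proj x)) (fun x => horig (origin_proj_rot x))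
      (fun x => by rw [proj_rev, h2]) (X.old d) (X.old e) hd
  · intro h Q h1 h2
    have hface : ∀ x, Q (X.unglue.faceNext x) ↔ Q x := fun x => by
      rw [RootedMap.faceNext, Equiv.Perm.mul_apply, h1, h2]
    have hcopy : ∀ s t, Q (X.copy s) ↔ Q (X.copy t) := by
      intro s t
      obtain ⟨n, hn⟩ := (faceNext_sameCycle_copy hT s t).exists_nat_pow_eq
      rw [← hn]
      clear hn
      induction n with
      | zero => rfl
      | succ n ih => rw [ih, pow_succ', Equiv.Perm.mul_apply, hface]
    have hold : ∀ s, Q (X.old (X.embed s)) ↔ Q (X.copy s) := fun s => by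
      rw [← h1, rot_old_embed, hcopy]
    have hall : ∀ d e, Q (X.old d) → Q (X.old e) := by
      refine h (fun d => Q (X.old d)) (fun d => ?_) (fun d => ?_)
      · by_cases hd : d ∈ X.decor
        · obtain ⟨s, rfl⟩ := exists_embed_eq hd
          rw [← rot_copy, h1, hold]
        · rw [← rot_old hd, h1]
      · by_cases hd : d ∈ X.decor
        · obtain ⟨s, rfl⟩ := exists_embed_eq hd
          rw [← rev_copy, h2, hold]
        · rw [← rev_old hd, h2]
    have hex : ∀ x, ∃ d, Q x ↔ Q (X.old d) := by
      intro x
      rcases X.old_or_copy x with ⟨d, rfl⟩ | ⟨s, rfl⟩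
      exacts [⟨d, Iff.rfl⟩, ⟨X.embed s, (hold s).symm⟩]
    intro x y hx
    obtain ⟨d, hd⟩ := hex x
    obtain ⟨e, he⟩ := hex y
    exact he.2 (hall d e (hd.1 hx))

theorem isPlanarMap_unglue_iff (hT : X.submap.IsPlaneTree m) :
    X.unglue.IsPlanarMap ↔ X.map.IsPlanarMap := by
  have h1 := card_vertex_unglue (X := X)
  rw [hT.card_vertex, hT.card_dart] at h1
  rw [RootedMap.IsPlanarMap, RootedMap.IsPlanarMap, connected_unglue_iff hT, card_face_unglue hT,
    card_edge_unglue hT]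
  -- Vertices plus faces change by `(m - 1) + 1`, which is the change in the number of edges.
  refine and_congr_right fun _ => ?_
  omega

theorem IsTreeDecorated.unglue (hX : X.IsTreeDecorated f m) : X.unglue.IsSimpleBoundaryMap f m where
  planar := (isPlanarMap_unglue_iff hX.tree).2 hX.planar
  card_face := by rw [card_face_unglue hX.tree, hX.card_face]
  size := by
    rw [rootFace_unglue hX.tree, ← Nat.card_coe_set_eq, Nat.card_range_of_injective X.copy_injective,
      hX.tree.card_dart]
  simple_vertex := by
    rw [rootFace_unglue hX.tree]
    rintro _ ⟨s, rfl⟩ _ ⟨t, rfl⟩ h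
    exact congrArg X.copy (origin_copy_injective h)
  simple_edge := by
    rw [rootFace_unglue hX.tree]
    rintro _ ⟨s, rfl⟩ ⟨t, ht⟩
    exact X.old_ne_copy _ _ ht.symm

theorem isTreeDecorated_of_unglue (hT : X.submap.IsPlaneTree m) (hp : X.unglue.IsPlanarMap)
    (hf : Nat.card X.unglue.Face = f + 1) : X.IsTreeDecorated f m where
  planar := (isPlanarMap_unglue_iff hT).1 hp
  card_face := by rw [card_face_unglue hT] at hf; omega
  tree := hT

/-! ### A decorated map is the gluing of its unglued map -/

theorem isGluingMap_proj (hT : X.submap.IsPlaneTree m) :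
    IsGluingMap m X.submap X.unglue X X.proj where
  surjective := X.proj_surjective
  map_rev := X.proj_rev
  map_root := rfl
  origin_eq_iff := by
    intro x y
    rw [origin_proj_eq_iff]
    refine or_congr_right ⟨?_, ?_⟩
    · rintro ⟨s, t, h, hs, ht⟩
      obtain ⟨i, hi, rfl⟩ := hT.exists_contourDart s
      obtain ⟨j, hj, rfl⟩ := hT.exists_contourDart t
      refine ⟨i, hi, j, hj, (hT.contourEquiv_iff hi.le hj.le).2 h, ?_, ?_⟩
      · rw [hs, boundaryDart_unglue]
      · rw [ht, boundaryDart_unglue]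
    · rintro ⟨i, hi, j, hj, h, hs, ht⟩
      rw [boundaryDart_unglue] at hs ht
      exact ⟨_, _, (hT.contourEquiv_iff hi.le hj.le).1 h, hs, ht⟩
  eq_iff := by
    have key : ∀ i < 2 * m, ∀ j < 2 * m, X.submap.Matched i j →
        X.proj (X.unglue.boundaryDart i) = X.proj (X.unglue.rev (X.unglue.boundaryDart j)) := by
      intro i hi j hj h
      rw [proj_rev, boundaryDart_unglue, boundaryDart_unglue, proj_copy, proj_copy, ← embed_rev,
        (hT.matched_iff hi hj).1 h]
    -- The only nontrivial fibres of `proj` are the pairs of a copy and its old dart. The witnesses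
    -- are the contour times of `s` and of its reverse.
    have key' : ∀ (s : X.submap.Dart), ∃ i < 2 * m, ∃ j < 2 * m, X.submap.Matched i j ∧
        X.copy s = X.unglue.boundaryDart i ∧
        X.old (X.embed s) = X.unglue.rev (X.unglue.boundaryDart j) := by
      intro s
      obtain ⟨i, hi, his⟩ := hT.exists_contourDart s
      obtain ⟨j, hj, hjs⟩ := hT.exists_contourDart (X.submap.rev s)
      refine ⟨i, hi, j, hj, (hT.matched_iff hi hj).2 ?_, ?_, ?_⟩
      · rw [his, hjs, X.submap.rev_rev]
      · rw [boundaryDart_unglue, his]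
      · rw [boundaryDart_unglue, hjs, rev_copy, ← embed_rev, X.submap.rev_rev]
    intro x y
    constructor
    · intro h
      rcases X.old_or_copy x with ⟨d, rfl⟩ | ⟨s, rfl⟩ <;>
        rcases X.old_or_copy y with ⟨e, rfl⟩ | ⟨t, rfl⟩
      · exact Or.inl (congrArg X.old h)
      · obtain rfl : d = X.embed t := h
        obtain ⟨i, hi, j, hj, h1, h2, h3⟩ := key' t
        exact Or.inr ⟨i, hi, j, hj, h1, Or.inr ⟨h2, h3⟩⟩
      · obtain rfl : X.embed s = e := h
        obtain ⟨i, hi, j, hj, h1, h2, h3⟩ := key' s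
        exact Or.inr ⟨i, hi, j, hj, h1, Or.inl ⟨h2, h3⟩⟩
      · exact Or.inl (congrArg X.copy (X.embed_injective h))
    · rintro (rfl | ⟨i, hi, j, hj, h, ⟨rfl, rfl⟩ | ⟨rfl, rfl⟩⟩)
      · rfl
      · exact key i hi j hj h
      · exact (key i hi j hj h).symm
  map_rot := by
    intro x hx
    rw [rootFace_unglue hT] at hx
    rcases X.old_or_copy x with ⟨d, rfl⟩ | ⟨s, rfl⟩
    · have hd : d ∉ X.decor := by
        intro hd
        obtain ⟨s, rfl⟩ := exists_embed_eq hd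
        exact hx ⟨_, (X.rev_old_embed s).symm⟩
      rw [rot_old hd, proj_old, proj_old]
    · rw [rot_copy, proj_old, proj_copy]
  decor_eq := by
    rw [rootFace_unglue hT]
    ext d
    constructor
    · intro hd
      obtain ⟨s, rfl⟩ := exists_embed_eq hd
      exact ⟨_, ⟨s, rfl⟩, rfl⟩
    · rintro ⟨_, ⟨s, rfl⟩, rfl⟩
      exact X.embed_mem s

end DecoratedMap

/-! ### The boundary walk of the root face -/

namespace RootedMap

theorem root_mem_rootFace (B : RootedMap) : B.root ∈ B.rootFace :=
  Equiv.Perm.SameCycle.refl _ _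

theorem faceNext_mem_rootFace_iff (B : RootedMap) {d : B.Dart} :
    B.faceNext d ∈ B.rootFace ↔ d ∈ B.rootFace :=
  Equiv.Perm.sameCycle_apply_right

theorem boundaryDart_mem_rootFace (B : RootedMap) (n : ℕ) : B.boundaryDart n ∈ B.rootFace :=
  Equiv.Perm.sameCycle_pow_right.2 (Equiv.Perm.SameCycle.refl _ _)

theorem boundaryDart_succ (B : RootedMap) (n : ℕ) :
    B.boundaryDart (n + 1) = B.faceNext (B.boundaryDart n) := by
  simp only [boundaryDart, pow_succ', Equiv.Perm.mul_apply]

theorem isCycleOn_rootFace (B : RootedMap) : B.faceNext.IsCycleOn B.rootFace := by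
  refine ⟨⟨fun d hd => B.faceNext_mem_rootFace_iff.2 hd, B.faceNext.injective.injOn, fun d hd =>
    ⟨B.faceNext⁻¹ d, B.faceNext_mem_rootFace_iff.1 (by simpa using hd), by simp⟩⟩, ?_⟩
  intro d hd e he
  exact Equiv.Perm.SameCycle.trans (Equiv.Perm.SameCycle.symm hd) he

theorem boundaryDart_eq_iff (B : RootedMap) (i j : ℕ) :
    B.boundaryDart i = B.boundaryDart j ↔ i ≡ j [MOD B.rootFace.ncard] := by
  have h : B.faceNext.IsCycleOn (B.rootFace.toFinite.toFinset : Set B.Dart) := by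
    rw [Set.Finite.coe_toFinset]; exact B.isCycleOn_rootFace
  have h2 := h.pow_apply_eq_pow_apply (a := B.root) (m := i) (n := j)
    ((Set.Finite.mem_toFinset _).2 B.root_mem_rootFace)
  rwa [← Set.ncard_eq_toFinset_card] at h2

theorem exists_boundaryDart (B : RootedMap) {d : B.Dart} (hd : d ∈ B.rootFace) :
    ∃ i < B.rootFace.ncard, B.boundaryDart i = d := by
  have h : B.faceNext.IsCycleOn (B.rootFace.toFinite.toFinset : Set B.Dart) := by
    rw [Set.Finite.coe_toFinset]; exact B.isCycleOn_rootFace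
  have h2 := h.exists_pow_eq (a := B.root) (b := d)
    ((Set.Finite.mem_toFinset _).2 B.root_mem_rootFace) ((Set.Finite.mem_toFinset _).2 hd)
  rwa [← Set.ncard_eq_toFinset_card] at h2

theorem Iso.contourEquiv_iff {T T' : RootedMap} (h : Iso T T') (i j : ℕ) :
    T.ContourEquiv i j ↔ T'.ContourEquiv i j := by
  rw [ContourEquiv, ContourEquiv, h.contour_eq]

theorem Iso.matched_iff {T T' : RootedMap} (h : Iso T T') (i j : ℕ) :
    T.Matched i j ↔ T'.Matched i j := by
  rw [Matched, Matched, h.contourEquiv_iff, h.contourEquiv_iff]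

theorem IsPlaneTree.exists_matched {T : RootedMap} {m : ℕ} (hT : T.IsPlaneTree m) {j : ℕ}
    (hj : j < 2 * m) : ∃ i < 2 * m, T.Matched i j := by
  obtain ⟨i, hi, h⟩ := hT.exists_contourDart (T.rev (T.contourDart j))
  exact ⟨i, hi, (hT.matched_iff hi hj).2 h⟩

end RootedMap

/-! ### Invariance and uniqueness of the gluing -/

theorem IsGluing.congr {m : ℕ} {T T' B B' : RootedMap} {X : DecoratedMap}
    (h : IsGluing m T B X) (hT : RootedMap.Iso T' T) (hB : RootedMap.Iso B' B) :
    IsGluing m T' B' X := by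
  obtain ⟨γ, hγ⟩ := h
  obtain ⟨e, h1, h2, h3⟩ := hB
  have hb := RootedMap.map_boundaryDart e h1 h2 h3
  have hf := RootedMap.map_mem_rootFace e h1 h2 h3
  have ho := RootedMap.map_origin_eq_iff e h1
  refine ⟨fun d => γ (e d), hγ.surjective.comp e.surjective, ?_, ?_, ?_, ?_, ?_, ?_⟩
  · intro d
    rw [h2, hγ.map_rev]
  · rw [h3, hγ.map_root]
  · intro d d'
    rw [hγ.origin_eq_iff]
    simp only [← hb, ho, hT.contourEquiv_iff]
  · intro d d'
    rw [hγ.eq_iff]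
    simp only [← hb, ← h2, e.apply_eq_iff_eq, hT.matched_iff]
  · intro d hd
    rw [hγ.map_rot _ (by rwa [← h2, hf]), h1]
  · rw [hγ.decor_eq]
    ext x
    constructor
    · rintro ⟨d, hd, rfl⟩
      exact ⟨e.symm d, (hf _).1 (by simpa using hd), by simp⟩
    · rintro ⟨d, hd, rfl⟩
      exact ⟨e d, (hf _).2 hd, rfl⟩

theorem IsGluing.congr_right {m : ℕ} {T B : RootedMap} {X Y : DecoratedMap}
    (h : IsGluing m T B X) (hXY : DecoratedMap.Iso X Y) : IsGluing m T B Y := by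
  obtain ⟨γ, hγ⟩ := h
  obtain ⟨e, h1, h2, h3, h4⟩ := hXY
  refine ⟨fun d => e (γ d), e.surjective.comp hγ.surjective, ?_, ?_, ?_, ?_, ?_, ?_⟩
  · intro d
    rw [hγ.map_rev, h2]
  · rw [hγ.map_root, h3]
  · intro d d'
    rw [RootedMap.map_origin_eq_iff e h1, hγ.origin_eq_iff]
  · intro d d'
    rw [e.apply_eq_iff_eq, hγ.eq_iff]
  · intro d hd
    rw [← h1, hγ.map_rot _ hd]
  · ext y
    obtain ⟨x, rfl⟩ := e.surjective y
    rw [h4, hγ.decor_eq]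
    constructor
    · rintro ⟨d, hd, rfl⟩
      exact ⟨d, hd, rfl⟩
    · rintro ⟨d, hd, h⟩
      exact ⟨d, hd, e.injective h⟩

/-- The rotation is prescribed only at darts that do not precede an external corner. The inner side
of a boundary edge does precede one, but it is identified with a boundary dart, whose reverse is off
the root face by simplicity. -/
theorem IsGluingMap.exists_preimage {m f : ℕ} {T B : RootedMap} {X : DecoratedMap}
    {γ : B.Dart → X.map.Dart} (h : IsGluingMap m T B X γ) (hT : T.IsPlaneTree m)
    (hB : B.IsSimpleBoundaryMap f m) (x : X.map.Dart) :
    ∃ d, γ d = x ∧ B.rev d ∉ B.rootFace := by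
  obtain ⟨d, rfl⟩ := h.surjective x
  by_cases hd : B.rev d ∈ B.rootFace
  · obtain ⟨j, hj, hjd⟩ := B.exists_boundaryDart hd
    rw [hB.size] at hj
    obtain ⟨i, hi, hij⟩ := hT.exists_matched hj
    refine ⟨B.boundaryDart i, (h.eq_iff _ _).2 (Or.inr ⟨i, hi, j, hj, hij, Or.inl ⟨rfl, ?_⟩⟩),
      hB.simple_edge _ (B.boundaryDart_mem_rootFace i)⟩
    rw [hjd, B.rev_rev]
  · exact ⟨d, rfl, hd⟩

/-- The fibres of a gluing depend only on `T` and `B`, so two gluings have canonically equivalent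
darts; choosing good preimages makes this equivalence respect rotation. -/
theorem IsGluing.unique {m f : ℕ} {T B : RootedMap} {X Y : DecoratedMap}
    (hX : IsGluing m T B X) (hY : IsGluing m T B Y) (hT : T.IsPlaneTree m)
    (hB : B.IsSimpleBoundaryMap f m) : DecoratedMap.Iso X Y := by
  obtain ⟨γ, hγ⟩ := hX
  obtain ⟨δ, hδ⟩ := hY
  have hfib : ∀ d d', γ d = γ d' ↔ δ d = δ d' := fun d d' => by rw [hγ.eq_iff, hδ.eq_iff]
  choose σ hσ using hγ.surjective
  have hφ : ∀ d, δ (σ (γ d)) = δ d := fun d => (hfib _ _).1 (hσ _)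
  let φ : X.map.Dart ≃ Y.map.Dart := Equiv.ofBijective (fun x => δ (σ x)) (by
    constructor
    · intro x y h
      rw [← hσ x, ← hσ y]
      exact (hfib _ _).2 h
    · intro y
      obtain ⟨d, rfl⟩ := hδ.surjective y
      exact ⟨γ d, hφ d⟩)
  have hφ' : ∀ d, φ (γ d) = δ d := hφ
  refine ⟨φ, fun x => ?_, fun x => ?_, ?_, fun x => ?_⟩
  · obtain ⟨d, rfl, hd⟩ := hγ.exists_preimage hT hB x
    rw [hγ.map_rot d hd, hφ', hφ', hδ.map_rot d hd]
  · obtain ⟨d, rfl⟩ := hγ.surjective x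
    rw [← hγ.map_rev, hφ', hφ', hδ.map_rev]
  · rw [← hγ.map_root, hφ', hδ.map_root]
  · obtain ⟨d, rfl⟩ := hγ.surjective x
    rw [hφ', hγ.decor_eq, hδ.decor_eq]
    simp only [Set.mem_image, hfib]

/-! ### Invariance of the ungluing -/

namespace DecoratedMap

theorem exists_submap_equiv {X Y : DecoratedMap} (e : X.map.Dart ≃ Y.map.Dart)
    (h1 : ∀ d, e (X.map.rot d) = Y.map.rot (e d)) (h2 : ∀ d, e (X.map.rev d) = Y.map.rev (e d))
    (h3 : e X.map.root = Y.map.root) (h4 : ∀ d, e d ∈ Y.decor ↔ d ∈ X.decor) :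
    ∃ φ : X.submap.Dart ≃ Y.submap.Dart, (∀ s, e (X.embed s) = Y.embed (φ s)) ∧
      (∀ s, φ (X.submap.rot s) = Y.submap.rot (φ s)) ∧
      (∀ s, φ (X.submap.rev s) = Y.submap.rev (φ s)) ∧ φ X.submap.root = Y.submap.root := by
  let φ : X.submap.Dart ≃ Y.submap.Dart :=
    e.subtypeEquiv (p := (· ∈ X.decor)) (q := (· ∈ Y.decor)) fun d => (h4 d).symm
  have hφ : ∀ s, Y.embed (φ s) = e (X.embed s) := fun s => rfl
  have hpow : ∀ (n : ℕ) d, (Y.map.rot ^ n) (e d) = e ((X.map.rot ^ n) d) := by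
    intro n d
    induction n with
    | zero => rfl
    | succ n ih => rw [pow_succ', pow_succ', Equiv.Perm.mul_apply, ih, ← h1]; rfl
  refine ⟨φ, fun s => rfl, fun s => ?_, fun s => ?_, ?_⟩
  · obtain ⟨n, hn, hmin⟩ := X.embed_rot_spec s
    symm
    refine Y.submap_rot_eq_of _ _ n ?_ fun k hk => ?_
    · rw [hφ, hφ, hpow, hn]
    · rw [hφ, hpow, h4]
      exact hmin k hk
  · exact Y.embed_injective (h2 _)
  · exact Y.embed_injective h3

theorem Iso.submap {X Y : DecoratedMap} (h : Iso X Y) : RootedMap.Iso X.submap Y.submap := by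
  obtain ⟨e, h1, h2, h3, h4⟩ := h
  obtain ⟨φ, -, h⟩ := exists_submap_equiv e h1 h2 h3 h4
  exact ⟨φ, h⟩

theorem Iso.unglue {X Y : DecoratedMap} (h : Iso X Y) : RootedMap.Iso X.unglue Y.unglue := by
  obtain ⟨e, h1, h2, h3, h4⟩ := h
  obtain ⟨φ, hφ, k1, k2, k3⟩ := exists_submap_equiv e h1 h2 h3 h4
  have k1' : ∀ s, φ (X.submap.rot⁻¹ s) = Y.submap.rot⁻¹ (φ s) := fun s => by
    rw [Equiv.Perm.eq_inv_iff_eq, ← k1]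
    simp
  let ε : X.unglue.Dart ≃ Y.unglue.Dart :=
    Equiv.sumCongr (α₁ := X.map.Dart) (β₁ := X.submap.Dart) e φ
  have hold : ∀ d, ε (X.old d) = Y.old (e d) := fun d => rfl
  have hcopy : ∀ s, ε (X.copy s) = Y.copy (φ s) := fun s => rfl
  refine ⟨ε, fun x => ?_, fun x => ?_, ?_⟩
  · rcases X.old_or_copy x with ⟨d, rfl⟩ | ⟨s, rfl⟩
    · by_cases hd : d ∈ X.decor
      · obtain ⟨s, rfl⟩ := exists_embed_eq hd
        rw [rot_old_embed, hcopy, hold, hφ, rot_old_embed, k1']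
      · rw [rot_old hd, hold, hold, rot_old ((h4 d).not.2 hd), h1]
    · rw [rot_copy, hold, hcopy, rot_copy, h1, hφ]
  · rcases X.old_or_copy x with ⟨d, rfl⟩ | ⟨s, rfl⟩
    · by_cases hd : d ∈ X.decor
      · obtain ⟨s, rfl⟩ := exists_embed_eq hd
        rw [rev_old_embed, hcopy, hold, hφ, rev_old_embed, k2]
      · rw [rev_old hd, hold, hold, rev_old ((h4 d).not.2 hd), h2]
    · rw [rev_copy, hold, hcopy, rev_copy, h2, hφ]
  · rw [unglue_root, hcopy, k3, unglue_root]

end DecoratedMap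

/-- An identification of the darts of a tree `T` with the boundary of `B` that takes the contour
walk of the tree to the boundary walk. -/
structure BoundaryMatching (T B : RootedMap) where
  toFun : T.Dart → B.Dart
  injective : Function.Injective toFun
  range_eq : Set.range toFun = B.rootFace
  map_contourNext : ∀ t, toFun (T.contourNext t) = B.faceNext (toFun t)
  map_root : toFun T.root = B.root
  simple_vertex : ∀ d ∈ B.rootFace, ∀ e ∈ B.rootFace, B.origin d = B.origin e → d = e
  simple_edge : ∀ d ∈ B.rootFace, B.rev d ∉ B.rootFace

/-- Both walks are cycles of length `2 * m`, so sending the `i`-th contour dart to the `i`-th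
boundary dart does not depend on the choice of `i`. -/
theorem RootedMap.IsPlaneTree.nonempty_boundaryMatching {T B : RootedMap} {m f : ℕ}
    (hT : T.IsPlaneTree m) (hB : B.IsSimpleBoundaryMap f m) : Nonempty (BoundaryMatching T B) := by
  choose ν hν hν' using hT.exists_contourDart
  have hiff : ∀ i j, B.boundaryDart i = B.boundaryDart j ↔ T.contourDart i = T.contourDart j := by
    intro i j
    rw [B.boundaryDart_eq_iff, hT.contourDart_eq_iff, hB.size]
  have hβ : ∀ i, B.boundaryDart (ν (T.contourDart i)) = B.boundaryDart i := fun i =>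
    (hiff _ _).2 (hν' _)
  refine ⟨⟨fun t => B.boundaryDart (ν t), ?_, ?_, ?_, ?_, hB.simple_vertex, hB.simple_edge⟩⟩
  · intro s t h
    rw [← hν' s, ← hν' t]
    exact (hiff _ _).1 h
  · ext d
    constructor
    · rintro ⟨t, rfl⟩
      exact B.boundaryDart_mem_rootFace _
    · intro hd
      obtain ⟨i, -, rfl⟩ := B.exists_boundaryDart hd
      exact ⟨T.contourDart i, hβ i⟩
  · intro t
    obtain ⟨i, -, rfl⟩ := hT.exists_contourDart t
    rw [hβ, ← B.boundaryDart_succ, ← hβ (i + 1), T.contourDart_succ]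
    rfl
  · exact hβ 0

/-! ### Construction of the glued map and its ungluing -/

namespace BoundaryMatching

variable {T B : RootedMap} (β : BoundaryMatching T B)

theorem mem_rootFace (t : T.Dart) : β.toFun t ∈ B.rootFace := β.range_eq ▸ Set.mem_range_self t

theorem exists_eq {d : B.Dart} (h : d ∈ B.rootFace) : ∃ t, β.toFun t = d := by
  rwa [← β.range_eq] at h

/-- The inner side of the edge on which a dart of the tree is glued. -/
def side (t : T.Dart) : B.Dart := B.rev (β.toFun (T.rev t))

theorem side_rev (t : T.Dart) : β.side (T.rev t) = B.rev (β.toFun t) := by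
  rw [side, T.rev_rev]

theorem rev_side (t : T.Dart) : B.rev (β.side t) = β.toFun (T.rev t) := B.rev_rev _

theorem side_injective : Function.Injective β.side :=
  B.rev.injective.comp (β.injective.comp T.rev.injective)

theorem side_notMem (t : T.Dart) : β.side t ∉ B.rootFace :=
  β.simple_edge _ (β.mem_rootFace _)

theorem exists_side_eq {d : B.Dart} (h : B.rev d ∈ B.rootFace) : ∃ t, β.side t = d := by
  obtain ⟨t, ht⟩ := β.exists_eq h
  exact ⟨T.rev t, by rw [side_rev, ht, B.rev_rev]⟩

theorem rot_side (t : T.Dart) : B.rot (β.side t) = β.toFun (T.rot⁻¹ t) := by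
  have := β.map_contourNext (T.rev t)
  simp only [RootedMap.contourNext, RootedMap.faceNext, Equiv.Perm.mul_apply, T.rev_rev] at this
  exact this.symm

theorem rot_toFun_notMem (t : T.Dart) : B.rot (β.toFun t) ∉ B.rootFace := by
  intro h
  have h1 := β.simple_vertex _ h _ (β.mem_rootFace t) (B.origin_rot _)
  apply β.simple_edge _ (β.mem_rootFace t)
  rw [← B.faceNext_mem_rootFace_iff, RootedMap.faceNext, Equiv.Perm.mul_apply, B.rev_rev]
  exact h

theorem rot_notMem {d : B.Dart} (h : ∀ t, β.side t ≠ d) : B.rot d ∉ B.rootFace := by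
  intro hd
  have : B.rev d ∈ B.rootFace := by
    rw [← B.faceNext_mem_rootFace_iff, RootedMap.faceNext, Equiv.Perm.mul_apply, B.rev_rev]
    exact hd
  obtain ⟨t, ht⟩ := β.exists_side_eq this
  exact h t ht

open Classical in
/-- Replaces the inner side of a glued edge by the boundary dart that is glued on it. -/
noncomputable def cross (d : B.Dart) : B.Dart :=
  if h : ∃ t, β.side t = d then β.toFun h.choose else d

theorem cross_side (t : T.Dart) : β.cross (β.side t) = β.toFun t := by
  have h : ∃ s, β.side s = β.side t := ⟨t, rfl⟩
  rw [cross, dif_pos h, β.side_injective h.choose_spec]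

theorem cross_eq {d : B.Dart} (h : ∀ t, β.side t ≠ d) : β.cross d = d :=
  dif_neg fun ⟨t, ht⟩ => h t ht

theorem side_or (d : B.Dart) : (∃ t, β.side t = d) ∨ ∀ t, β.side t ≠ d := by
  by_cases h : ∃ t, β.side t = d
  · exact Or.inl h
  · exact Or.inr fun t ht => h ⟨t, ht⟩

theorem rot_cross_notMem (d : B.Dart) : B.rot (β.cross d) ∉ B.rootFace := by
  rcases β.side_or d with ⟨t, rfl⟩ | h
  · rw [cross_side]; exact β.rot_toFun_notMem t
  · rw [β.cross_eq h]; exact β.rot_notMem h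

theorem rev_cross_notMem {d : B.Dart} : B.rev (β.cross d) ∉ B.rootFace := by
  rcases β.side_or d with ⟨t, rfl⟩ | h
  · rw [cross_side]; exact β.simple_edge _ (β.mem_rootFace t)
  · rw [β.cross_eq h]
    intro hd
    obtain ⟨t, ht⟩ := β.exists_side_eq hd
    exact h t ht

theorem cross_injOn {d e : B.Dart} (hd : d ∉ B.rootFace) (he : e ∉ B.rootFace)
    (h : β.cross d = β.cross e) : d = e := by
  rcases β.side_or d with ⟨s, rfl⟩ | hs <;> rcases β.side_or e with ⟨t, rfl⟩ | ht
  · rw [cross_side, cross_side] at h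
    rw [β.injective h]
  · rw [cross_side, β.cross_eq ht] at h
    exact absurd (h ▸ β.mem_rootFace s) he
  · rw [cross_side, β.cross_eq hs] at h
    exact absurd (h ▸ β.mem_rootFace t) hd
  · rwa [β.cross_eq hs, β.cross_eq ht] at h

theorem rev_cross_rev_cross {d : B.Dart} (hd : d ∉ B.rootFace) :
    B.rev (β.cross (B.rev (β.cross d))) = d := by
  rcases β.side_or d with ⟨t, rfl⟩ | h
  · rw [cross_side, ← side_rev, cross_side]
    rfl
  · have h' : ∀ t, β.side t ≠ B.rev d := by
      intro t ht
      apply hd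
      rw [← B.rev_rev d, ← ht, rev_side]
      exact β.mem_rootFace _
    rw [β.cross_eq h, β.cross_eq h', B.rev_rev]

theorem rev_cross_ne {d : B.Dart} : B.rev (β.cross d) ≠ d := by
  rcases β.side_or d with ⟨t, rfl⟩ | h
  · rw [cross_side, ← side_rev]
    exact fun h => T.rev_ne t (β.side_injective h)
  · rw [β.cross_eq h]
    exact B.rev_ne d

/-- The decorated map obtained by gluing the boundary of `B` to `T`. -/
noncomputable def glue : DecoratedMap where
  map :=
    { Dart := {d : B.Dart // d ∉ B.rootFace}
      finite := inferInstance
      -- Each glued pair is represented by its inner side. Rotating an inner side in `B` would enter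
      -- the external corner, so the rotation continues instead from the boundary dart glued on it.
      rot := Equiv.ofBijective (fun d => ⟨B.rot (β.cross d), β.rot_cross_notMem d⟩)
        (Finite.injective_iff_bijective.1 fun d e h => Subtype.ext
          (β.cross_injOn d.2 e.2 (B.rot.injective (congrArg Subtype.val h))))
      rev := Function.Involutive.toPerm (fun d => ⟨B.rev (β.cross d), β.rev_cross_notMem⟩)
        fun d => Subtype.ext (β.rev_cross_rev_cross d.2)
      rev_rev := fun d => Subtype.ext (β.rev_cross_rev_cross d.2)
      rev_ne := fun d h => β.rev_cross_ne (congrArg Subtype.val h)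
      root := ⟨β.side T.root, β.side_notMem _⟩ }
  decor := Set.range fun t => ⟨β.side t, β.side_notMem t⟩
  rev_mem := by
    rintro _ ⟨t, rfl⟩
    refine ⟨T.rev t, Subtype.ext ?_⟩
    change _ = B.rev (β.cross (β.side t))
    rw [cross_side]
    exact β.side_rev t
  root_mem := ⟨T.root, rfl⟩

/-- The dart of `B` from which a dart of the glued map comes. -/
def val (d : β.glue.map.Dart) : B.Dart := Subtype.val (p := (· ∉ B.rootFace)) d

theorem val_injective : Function.Injective β.val := Subtype.val_injective

theorem val_notMem (d : β.glue.map.Dart) : β.val d ∉ B.rootFace :=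
  Subtype.prop (p := (· ∉ B.rootFace)) d

theorem exists_val_eq {d : B.Dart} (h : d ∉ B.rootFace) : ∃ x, β.val x = d := ⟨⟨d, h⟩, rfl⟩

theorem val_rot (d : β.glue.map.Dart) : β.val (β.glue.map.rot d) = B.rot (β.cross (β.val d)) := rfl

theorem val_rev (d : β.glue.map.Dart) : β.val (β.glue.map.rev d) = B.rev (β.cross (β.val d)) := rfl

theorem mem_decor_iff (d : β.glue.map.Dart) : d ∈ β.glue.decor ↔ ∃ t, β.side t = β.val d := by
  constructor
  · rintro ⟨t, rfl⟩
    exact ⟨t, rfl⟩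
  · rintro ⟨t, ht⟩
    exact ⟨t, β.val_injective ht⟩

/-- The darts of the tree as darts of the decoration of the glued map. -/
noncomputable def treeEquiv : T.Dart ≃ β.glue.submap.Dart :=
  Equiv.ofInjective (β := {d : B.Dart // d ∉ B.rootFace}) (fun t => ⟨β.side t, β.side_notMem t⟩)
    fun _ _ h => β.side_injective (congrArg Subtype.val h)

theorem val_embed_treeEquiv (t : T.Dart) : β.val (β.glue.embed (β.treeEquiv t)) = β.side t := rfl

theorem treeEquiv_rev (t : T.Dart) : β.treeEquiv (T.rev t) = β.glue.submap.rev (β.treeEquiv t) := by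
  apply β.glue.embed_injective
  apply β.val_injective
  rw [val_embed_treeEquiv, DecoratedMap.embed_rev, val_rev, val_embed_treeEquiv, cross_side,
    side_rev]

theorem treeEquiv_root : β.treeEquiv T.root = β.glue.submap.root := rfl

theorem treeEquiv_rot (t : T.Dart) : β.treeEquiv (T.rot t) = β.glue.submap.rot (β.treeEquiv t) := by
  -- First return to a singleton measures the full rotation cycle of the boundary dart in `B`, that
  -- is, one corner of the tree. Its length is at least two, as rotating a boundary dart once leaves
  -- the root face.
  obtain ⟨n, hn, hmin⟩ := firstReturn_spec B.finite B.rot {β.toFun t} ⟨β.toFun t, rfl⟩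
  rw [Set.mem_singleton_iff.1 (Subtype.prop (firstReturn _ _ _ _))] at hn
  simp only [Set.mem_singleton_iff] at hn hmin
  obtain ⟨n, rfl⟩ : ∃ l, n = l + 1 := by
    refine Nat.exists_eq_succ_of_ne_zero ?_
    rintro rfl
    exact β.rot_toFun_notMem t (by
      rw [zero_add, pow_one] at hn
      rw [hn]
      exact β.mem_rootFace t)
  -- Rotating an inner side gives a boundary dart. At this vertex the only one is `β.toFun t`, so an
  -- inner side can occur only at the very end of the cycle.
  have hside : ∀ k < n, ∀ s, β.side s ≠ (B.rot ^ (k + 1)) (β.toFun t) := by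
    intro k hk s hs
    have h1 : B.rot (β.side s) = (B.rot ^ (k + 1 + 1)) (β.toFun t) := by
      rw [hs, pow_succ' _ (k + 1), Equiv.Perm.mul_apply]
    refine hmin (k + 1) (by omega) (h1 ▸ β.simple_vertex _ ?_ _ (β.mem_rootFace t) ?_)
    · rw [rot_side]; exact β.mem_rootFace _
    · rw [h1, B.origin_rot_pow]
  have hval : ∀ k ≤ n, β.val ((β.glue.map.rot ^ (k + 1)) (β.glue.embed (β.treeEquiv t))) =
      (B.rot ^ (k + 1)) (β.toFun t) := by
    intro k
    induction k with
    | zero =>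
      intro _
      rw [zero_add, pow_one, pow_one, val_rot, val_embed_treeEquiv, cross_side]
    | succ k ih =>
      intro hk
      rw [pow_succ' _ (k + 1), Equiv.Perm.mul_apply, val_rot, ih (by omega),
        β.cross_eq (hside k (by omega)), pow_succ' _ (k + 1), Equiv.Perm.mul_apply]
  symm
  refine β.glue.submap_rot_eq_of _ _ n (β.val_injective ?_) fun k hk => ?_
  · rw [hval n le_rfl, val_embed_treeEquiv]
    apply B.rot.injective
    rw [← Equiv.Perm.mul_apply, ← pow_succ', hn, rot_side]
    simp
  · rw [mem_decor_iff, hval k hk.le]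
    rintro ⟨s, hs⟩
    exact hside k hk s hs

theorem iso_submap : RootedMap.Iso T β.glue.submap :=
  ⟨β.treeEquiv, β.treeEquiv_rot, β.treeEquiv_rev, β.treeEquiv_root⟩

theorem treeEquiv_rot_inv (t : T.Dart) :
    β.glue.submap.rot⁻¹ (β.treeEquiv t) = β.treeEquiv (T.rot⁻¹ t) := by
  rw [Equiv.Perm.inv_eq_iff_eq, ← treeEquiv_rot]
  simp

/-- The darts of the unglued map of the glued map are the darts of `B`. -/
noncomputable def unglueFun : β.glue.unglue.Dart → B.Dart :=
  Sum.elim (α := β.glue.map.Dart) (β := β.glue.submap.Dart) β.val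
    fun s => β.toFun (β.treeEquiv.symm s)

theorem unglueFun_old (d : β.glue.map.Dart) : β.unglueFun (β.glue.old d) = β.val d := rfl

theorem unglueFun_copy (t : T.Dart) :
    β.unglueFun (β.glue.copy (β.treeEquiv t)) = β.toFun t :=
  congrArg β.toFun (β.treeEquiv.symm_apply_apply t)

theorem unglueFun_bijective : Function.Bijective β.unglueFun := by
  constructor
  · intro x y h
    rcases β.glue.old_or_copy x with ⟨d, rfl⟩ | ⟨s, rfl⟩ <;>
      rcases β.glue.old_or_copy y with ⟨e, rfl⟩ | ⟨t, rfl⟩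
    · exact congrArg _ (β.val_injective h)
    · obtain ⟨t, rfl⟩ := β.treeEquiv.surjective t
      rw [unglueFun_old, unglueFun_copy] at h
      exact absurd (h ▸ β.mem_rootFace t) (β.val_notMem d)
    · obtain ⟨s, rfl⟩ := β.treeEquiv.surjective s
      rw [unglueFun_old, unglueFun_copy] at h
      exact absurd (h ▸ β.mem_rootFace s) (β.val_notMem e)
    · obtain ⟨s, rfl⟩ := β.treeEquiv.surjective s
      obtain ⟨t, rfl⟩ := β.treeEquiv.surjective t
      rw [unglueFun_copy, unglueFun_copy] at h
      rw [β.injective h]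
  · intro d
    by_cases hd : d ∈ B.rootFace
    · obtain ⟨t, rfl⟩ := β.exists_eq hd
      exact ⟨_, β.unglueFun_copy t⟩
    · obtain ⟨x, rfl⟩ := β.exists_val_eq hd
      exact ⟨_, β.unglueFun_old x⟩

theorem iso_unglue : RootedMap.Iso β.glue.unglue B := by
  have hcases : ∀ d : β.glue.map.Dart, (∃ t, d = β.glue.embed (β.treeEquiv t)) ∨
      (d ∉ β.glue.decor ∧ ∀ t, β.side t ≠ β.val d) := by
    intro d
    by_cases hd : d ∈ β.glue.decor
    · obtain ⟨s, rfl⟩ := DecoratedMap.exists_embed_eq hd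
      obtain ⟨t, rfl⟩ := β.treeEquiv.surjective s
      exact Or.inl ⟨t, rfl⟩
    · exact Or.inr ⟨hd, fun t ht => hd ((β.mem_decor_iff d).2 ⟨t, ht⟩)⟩
  refine ⟨Equiv.ofBijective _ β.unglueFun_bijective, fun x => ?_, fun x => ?_, ?_⟩
  · change β.unglueFun _ = B.rot (β.unglueFun x)
    rcases β.glue.old_or_copy x with ⟨d, rfl⟩ | ⟨s, rfl⟩
    · rcases hcases d with ⟨t, rfl⟩ | ⟨hd, ht⟩
      · rw [DecoratedMap.rot_old_embed, treeEquiv_rot_inv, unglueFun_copy, unglueFun_old,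
          val_embed_treeEquiv, rot_side]
      · rw [DecoratedMap.rot_old hd, unglueFun_old, unglueFun_old, val_rot, β.cross_eq ht]
    · obtain ⟨t, rfl⟩ := β.treeEquiv.surjective s
      rw [DecoratedMap.rot_copy, unglueFun_old, unglueFun_copy, val_rot, val_embed_treeEquiv,
        cross_side]
  · change β.unglueFun _ = B.rev (β.unglueFun x)
    rcases β.glue.old_or_copy x with ⟨d, rfl⟩ | ⟨s, rfl⟩
    · rcases hcases d with ⟨t, rfl⟩ | ⟨hd, ht⟩
      · rw [DecoratedMap.rev_old_embed, ← treeEquiv_rev, unglueFun_copy, unglueFun_old,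
          val_embed_treeEquiv, rev_side]
      · rw [DecoratedMap.rev_old hd, unglueFun_old, unglueFun_old, val_rev, β.cross_eq ht]
    · obtain ⟨t, rfl⟩ := β.treeEquiv.surjective s
      rw [DecoratedMap.rev_copy, unglueFun_old, unglueFun_copy, val_rev, val_embed_treeEquiv,
        cross_side]
  · change β.unglueFun β.glue.unglue.root = _
    rw [DecoratedMap.unglue_root, ← treeEquiv_root, unglueFun_copy, β.map_root]

end BoundaryMatching

/-- Planarity and the number of faces of the glued map are not computed directly: they are inherited
from `B` through its ungluing. -/
theorem exists_isTreeDecorated {T B : RootedMap} {m f : ℕ} (hT : T.IsPlaneTree m)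
    (hB : B.IsSimpleBoundaryMap f m) : ∃ X : DecoratedMap, X.IsTreeDecorated f m ∧
      RootedMap.Iso X.submap T ∧ RootedMap.Iso X.unglue B := by
  obtain ⟨β⟩ := hT.nonempty_boundaryMatching hB
  have hu : RootedMap.Iso B β.glue.unglue := RootedMap.isoSetoid.symm β.iso_unglue
  exact ⟨β.glue, DecoratedMap.isTreeDecorated_of_unglue (β.iso_submap.isPlaneTree hT)
    (hu.isPlanarMap hB.planar) (hu.card_face ▸ hB.card_face), RootedMap.isoSetoid.symm β.iso_submap,
    β.iso_unglue⟩

/-! ### The bijection -/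

/-- A decorated map is the gluing of its unglued map along its decoration. -/
theorem DecoratedMap.IsTreeDecorated.isGluing {X : DecoratedMap} {f m : ℕ}
    (hX : X.IsTreeDecorated f m) {T B : RootedMap} (hT : RootedMap.Iso T X.submap)
    (hB : RootedMap.Iso B X.unglue) : IsGluing m T B X :=
  IsGluing.congr ⟨X.proj, DecoratedMap.isGluingMap_proj hX.tree⟩ hT hB

/-- The ungluing on isomorphism classes. -/
noncomputable def unglueClass : DecoratedMapClass → MapClass × MapClass :=
  Quotient.lift (fun X => (⟦X.submap⟧, ⟦X.unglue⟧)) fun _ _ h =>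
    Prod.ext (Quotient.sound (DecoratedMap.Iso.submap h))
      (Quotient.sound (DecoratedMap.Iso.unglue h))

theorem unglueClass_mem {f m : ℕ} (x : TreeDecoratedMaps f m) :
    (unglueClass x).1 ∈ PlaneTrees m ∧ (unglueClass x).2 ∈ SimpleBoundaryMaps f m := by
  obtain ⟨_, X, hX, rfl⟩ := x
  exact ⟨⟨X.submap, hX.tree, rfl⟩, ⟨X.unglue, hX.unglue, rfl⟩⟩

/-- The ungluing of tree-decorated maps. -/
noncomputable def unglueTreeDecorated (f m : ℕ) (x : TreeDecoratedMaps f m) :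
    PlaneTrees m × SimpleBoundaryMaps f m :=
  (⟨_, (unglueClass_mem x).1⟩, ⟨_, (unglueClass_mem x).2⟩)

theorem unglueTreeDecorated_bijective (f m : ℕ) :
    Function.Bijective (unglueTreeDecorated f m) := by
  constructor
  · rintro ⟨_, X, hX, rfl⟩ ⟨_, Y, hY, rfl⟩ h
    have h1 : (⟦X.submap⟧ : MapClass) = ⟦Y.submap⟧ := congrArg (fun p => (p.1 : MapClass)) h
    have h2 : (⟦X.unglue⟧ : MapClass) = ⟦Y.unglue⟧ := congrArg (fun p => (p.2 : MapClass)) h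
    have hX' := hX.isGluing (RootedMap.isoSetoid.refl _) (RootedMap.isoSetoid.refl _)
    have hY' := hY.isGluing (Quotient.exact h1) (Quotient.exact h2)
    exact Subtype.ext (Quotient.sound (hX'.unique hY' hX.tree hX.unglue))
  · rintro ⟨⟨_, T, hT, rfl⟩, ⟨_, B, hB, rfl⟩⟩
    obtain ⟨X, hX, h1, h2⟩ := exists_isTreeDecorated hT hB
    exact ⟨⟨⟦X⟧, X, hX, rfl⟩, Prod.ext (Subtype.ext (Quotient.sound h1))
      (Subtype.ext (Quotient.sound h2))⟩

theorem theorem1 (f m : ℕ) :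
    ∃ Φ : TreeDecoratedMaps f m ≃ PlaneTrees m × SimpleBoundaryMaps f m,
      (∀ (x : TreeDecoratedMaps f m) (X : DecoratedMap), ⟦X⟧ = (x : DecoratedMapClass) →
        ((Φ x).1 : MapClass) = ⟦X.submap⟧ ∧ ((Φ x).2 : MapClass) = ⟦X.unglue⟧) ∧
      (∀ (t : PlaneTrees m) (b : SimpleBoundaryMaps f m) (T B : RootedMap) (X : DecoratedMap),
        ⟦T⟧ = (t : MapClass) → ⟦B⟧ = (b : MapClass) →
          (((Φ.symm (t, b) : TreeDecoratedMaps f m) : DecoratedMapClass) = ⟦X⟧ ↔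
            IsGluing m T B X)) := by
  let Φ := Equiv.ofBijective _ (unglueTreeDecorated_bijective f m)
  have hΦ : ∀ (x : TreeDecoratedMaps f m) (X : DecoratedMap), ⟦X⟧ = (x : DecoratedMapClass) →
      ((Φ x).1 : MapClass) = ⟦X.submap⟧ ∧ ((Φ x).2 : MapClass) = ⟦X.unglue⟧ := by
    rintro ⟨_, hx⟩ X rfl
    exact ⟨rfl, rfl⟩
  refine ⟨Φ, hΦ, ?_⟩
  intro t b T B X hT hB
  obtain ⟨Y, hY, hYc⟩ := (Φ.symm (t, b)).2
  obtain ⟨h1, h2⟩ := hΦ _ Y hYc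
  rw [Equiv.apply_symm_apply] at h1 h2
  have hTY : RootedMap.Iso T Y.submap := Quotient.exact (hT.trans h1)
  have hBY : RootedMap.Iso B Y.unglue := Quotient.exact (hB.trans h2)
  rw [← hYc]
  constructor
  · intro h
    exact (hY.isGluing hTY hBY).congr_right (Quotient.exact h)
  -- Here `X` is not known to be tree-decorated; uniqueness of the gluing asks for nothing beyond
  -- the tree and the simple boundary of the data being glued.
  · intro h
    have hX : IsGluing m Y.submap Y.unglue X := h.congr (RootedMap.isoSetoid.symm hTY) (RootedMap.isoSetoid.symm hBY)
    exact Quotient.sound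
      ((hY.isGluing (RootedMap.isoSetoid.refl _) (RootedMap.isoSetoid.refl _)).unique hX hY.tree hY.unglue)
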